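/- Let \[ \mathcal A=\Big\{(a,b,c)\in \tfrac12\mathbb Z\times\tfrac12\mathbb Z\times\mathbb Z : a+b\in\mathbb Z\Big\}. \] A (not necessarily convex) lattice polygon $P$ is the closed region of $\mathbb R^2$ consisting of a simple closed broken line $\partial P$ with vertices in $\mathbb Z^2$ and the bounded part of the plane that it encloses. Let $v_1,\dots,v_d$ ($d\ge 3$) be the vertices of $P$ in counterclockwise order, $v_{d+1}=v_1$, and let $n_i$ be the normal vector to the side $v_iv_{i+1}$ whose rotation by $90$ degrees counterclockwise has the direction of $v_{i+1}-v_i$. Let $A(P)$ be the area of $P$, let $B(P)=|\partial P\cap\mathbb Z^2|$ be the number of lattice points on its boundary, and let $C(P)$ be the rotation number of the cyclic sequence $n_1,\dots,n_d$, that is, $\frac1{2\pi}$ times the sum of the oriented angles in $(-\pi,\pi]$ from $n_i$ to $n_{i+1}$, where $n_{d+1}=n_1$. Then, for every triple $(a,b,c)\in\mathcal A$, there is a lattice polygon $P$ with \[ (a,b,c)=\big(A(P),\tfrac12B(P),C(P)\big) \] if and only if $c=1$ and $a+1\ge b\ge\frac32$. -/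

import Mathlib

/-- The inclusion `ℤ² ⊆ ℝ²` of the lattice in the plane. -/
def latticePoint (p : ℤ × ℤ) : ℝ × ℝ := ((p.1 : ℝ), (p.2 : ℝ))

/-- The set `𝒜 = {(a, b, c) ∈ ½ℤ × ½ℤ × ℤ : a + b ∈ ℤ}`. -/
def admissibleTriples : Set (ℝ × ℝ × ℤ) :=
  {t | (∃ k : ℤ, t.1 = (k : ℝ) / 2) ∧ (∃ l : ℤ, t.2.1 = (l : ℝ) / 2) ∧
    ∃ m : ℤ, t.1 + t.2.1 = (m : ℝ)}

/-- A (not necessarily convex) lattice polygon, given by the cyclic sequence of its vertices in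
counterclockwise order. There are `n + 3` vertices, so there are at least three, and addition of
indices in `Fin (n + 3)` is cyclic: the side number `i` goes from `vertex i` to `vertex (i + 1)`,
and the last side returns to the first vertex. A vertex may have a straight angle. -/
structure LatticePolygon where
  /-- The number of vertices minus three. -/
  n : ℕ
  /-- The vertices. -/
  vertex : Fin (n + 3) → ℤ × ℤ
  /-- The closed broken line through the vertices is simple: its parametrization, which runs through
  the side `i` with parameter `s ∈ [0, 1)`, is injective. -/
  simple : ∀ i j : Fin (n + 3), ∀ s ∈ Set.Ico (0 : ℝ) 1, ∀ t ∈ Set.Ico (0 : ℝ) 1,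
    AffineMap.lineMap (latticePoint (vertex i)) (latticePoint (vertex (i + 1))) s =
      AffineMap.lineMap (latticePoint (vertex j)) (latticePoint (vertex (j + 1))) t →
    i = j ∧ s = t
  /-- The vertices are in counterclockwise order: (twice) the signed area, that is the line integral
  of `x dy - y dx` along the broken line, is positive. -/
  counterclockwise : 0 < ∑ i : Fin (n + 3),
    ((vertex i).1 * (vertex (i + 1)).2 - (vertex (i + 1)).1 * (vertex i).2)

/-- The sum of the oriented angles, each taken in `(-π, π]`, from every vector of a cyclic sequence of
nonzero vectors of the plane `ℂ` to the next one, divided by `2π`. -/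
noncomputable def rotationNumber {n : ℕ} (w : Fin (n + 3) → ℂ) : ℝ :=
  (∑ i : Fin (n + 3), Complex.arg (w (i + 1) / w i)) / (2 * Real.pi)

namespace LatticePolygon

/-- The boundary `∂P`: the union of the sides. -/
def boundary (P : LatticePolygon) : Set (ℝ × ℝ) :=
  ⋃ i : Fin (P.n + 3),
    segment ℝ (latticePoint (P.vertex i)) (latticePoint (P.vertex (i + 1)))

/-- The polygon `P` as a subset of the plane: its boundary together with the part of the plane that
is enclosed by it, that is the bounded connected components of the complement of the boundary. -/
def region (P : LatticePolygon) : Set (ℝ × ℝ) :=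
  P.boundary ∪
    {x | x ∉ P.boundary ∧ Bornology.IsBounded (connectedComponentIn P.boundaryᶜ x)}

/-- `A(P)`: the area (Lebesgue measure) of `P`. -/
noncomputable def A (P : LatticePolygon) : ℝ := MeasureTheory.volume.real P.region

/-- `B(P)`: the number of lattice points on the boundary of `P`. -/
noncomputable def B (P : LatticePolygon) : ℕ :=
  {p : ℤ × ℤ | latticePoint p ∈ P.boundary}.ncard

/-- The normal vector `nᵢ` to the side from `vertex i` to `vertex (i + 1)`, as a complex number:
turned by 90 degrees (multiplied by `I`), it is the vector of the side. -/
noncomputable def normal (P : LatticePolygon) (i : Fin (P.n + 3)) : ℂ :=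
  ⟨((P.vertex (i + 1)).2 - (P.vertex i).2 : ℝ), -((P.vertex (i + 1)).1 - (P.vertex i).1 : ℝ)⟩

/-- `C(P)`: the rotation number of the sequence of normal vectors to the sides. -/
noncomputable def C (P : LatticePolygon) : ℝ := rotationNumber P.normal

end LatticePolygon

/-! Everything rests on one function: the angle under which the boundary is seen from a point x,
where a side through x counts as 0. For a simple loop of total turning T this angle is T/2 + π or
T/2 - π off the loop, T/2 minus the exterior angle at a vertex, and T/2 at the other points of the
loop. The value at a vertex comes from a discrete form of Hopf's secant argument
(`two_mul_sum_sight`); the values off the loop are limits along rays into a point of the loop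
(`exists_local_sides`). The angle vanishes far away, so T = ±2π (`totalTurn_eq_or`). Since the loop
is connected, the points of angle 0 form one component when T = 2π, and the enclosed points are
those of angle 2π.

The angle of a triangle is an alternating cocycle. Its integral against a measure invariant under
lattice translations and x ↦ -x is therefore an alternating bilinear function of the edges, a
multiple of the determinant (`eq_latticeDet_mul_of_cocycle`). The unit square gives the same factor
for Lebesgue measure and for counting measure on ℤ², so both integrals of the winding angle equal
πS, with S the shoelace sum. For Lebesgue measure, S > 0 excludes T = -2π, whence C = 1, and then A
= S/2. For counting measure, the boundary contributes (B - 2)π and every other lattice point 0 or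
2π, so B - 2 ≤ S = 2A, which is a + 1 ≥ b. Finally B ≥ 3, since the vertices are distinct.

Conversely, the polygon (0,0), (k,0), (j,1), (1,2) has B = k + 3 and 2A = k + 2j - 1: k adjusts the
boundary, and j adds area without adding boundary points. -/

open Complex

/-! ### Angles of sight and their addition rules -/

/-- The argument of a complex number, with the value `π` replaced by `0`, so that it is an odd
function of the direction. -/
noncomputable def cutArg (z : ℂ) : ℝ := if z.arg = Real.pi then 0 else z.arg

/-- The oriented angle at which the segment from `a` to `b` is seen from `x`; it is `0` when `x`
lies on the segment. -/
noncomputable def sight (x a b : ℂ) : ℝ := cutArg ((b - x) / (a - x))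

/-- The oriented angle from `b - a` to `c - b`. -/
noncomputable def turnAngle (a b c : ℂ) : ℝ := ((c - b) / (b - a)).arg

/-- A simple closed polygonal line with sides from `q i` to `q (i + 1)`, where `i ≤ m`. -/
structure IsSimpleLoop (m : ℕ) (q : ℕ → ℂ) : Prop where
  two_le : 2 ≤ m
  closed : q (m + 1) = q 0
  turn : ∀ i < m, (q (i + 2) - q (i + 1)) / (q (i + 1) - q i) ∈ slitPlane
  turn_last : (q 1 - q 0) / (q 0 - q m) ∈ slitPlane
  disj : ∀ i j, i + 1 < j → j ≤ m → (i ≠ 0 ∨ j ≠ m) →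
    Disjoint (segment ℝ (q i) (q (i + 1))) (segment ℝ (q j) (q (j + 1)))

/-- The sum of the oriented exterior angles of a closed polygonal line. -/
noncomputable def totalTurn (m : ℕ) (q : ℕ → ℂ) : ℝ :=
  ∑ i ∈ Finset.range m, turnAngle (q i) (q (i + 1)) (q (i + 2)) + turnAngle (q m) (q 0) (q 1)

theorem cutArg_of_mem_slitPlane {z : ℂ} (h : z ∈ slitPlane) : cutArg z = z.arg := by
  rw [cutArg, if_neg (mem_slitPlane_iff_arg.1 h).1]

theorem cutArg_inv (z : ℂ) : cutArg z⁻¹ = -cutArg z := by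
  unfold cutArg
  rw [arg_inv]
  by_cases h : z.arg = Real.pi
  · simp [h]
  · have : -z.arg ≠ Real.pi := by
      have := neg_pi_lt_arg z
      intro h'; linarith
    simp [h, this]

theorem abs_cutArg_le (z : ℂ) : |cutArg z| ≤ Real.pi := by
  unfold cutArg
  split_ifs
  · simpa using Real.pi_pos.le
  · exact abs_arg_le_pi z

theorem sight_swap (x a b : ℂ) : sight x b a = -sight x a b := by
  rw [sight, sight, ← cutArg_inv, inv_div]

theorem arg_div_of_re_pos {a b : ℂ} (ha : 0 < a.re) (hb : 0 < b.re) :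
    (b / a).arg = b.arg - a.arg := by
  have ha0 : a ≠ 0 := by rintro rfl; simp at ha
  have hb0 : b ≠ 0 := by rintro rfl; simp at hb
  have h1 := abs_lt.1 (abs_arg_lt_pi_div_two_iff.2 (Or.inl ha))
  have h2 := abs_lt.1 (abs_arg_lt_pi_div_two_iff.2 (Or.inl hb))
  have hinv : (a⁻¹).arg = -a.arg := by
    rw [arg_inv, if_neg]; intro h; linarith [Real.pi_pos]
  rw [div_eq_mul_inv, arg_mul hb0 (inv_ne_zero ha0), hinv, sub_eq_add_neg]
  rw [hinv]
  constructor <;> linarith [Real.pi_pos]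

/-- Multiplication by k brings both vectors into the right half-plane, where arguments lie in (-π/2,
π/2) and their difference cannot wrap around. With a common half-plane, sums of angles thus
telescope exactly, not only modulo 2π. -/
theorem cutArg_div_of_re_pos {k u v : ℂ} (hu : 0 < (k * u).re) (hv : 0 < (k * v).re) :
    cutArg (v / u) = (k * v).arg - (k * u).arg := by
  have hk : k ≠ 0 := by rintro rfl; simp at hu
  have h1 := abs_lt.1 (abs_arg_lt_pi_div_two_iff.2 (Or.inl hu))
  have h2 := abs_lt.1 (abs_arg_lt_pi_div_two_iff.2 (Or.inl hv))
  have h : (v / u).arg = (k * v).arg - (k * u).arg := by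
    rw [← arg_div_of_re_pos hu hv, mul_div_mul_left _ _ hk]
  rw [cutArg, h, if_neg]
  intro h; linarith

theorem exists_re_pos_of_disjoint_segment {a b c d : ℂ}
    (h : Disjoint (segment ℝ a b) (segment ℝ c d)) :
    ∃ k : ℂ, ∀ z ∈ segment ℝ a b, ∀ w ∈ segment ℝ c d, 0 < (k * (w - z)).re := by
  obtain ⟨f, u, v, hu, huv, hv⟩ := geometric_hahn_banach_compact_closed (convex_segment a b)
    (by rw [segment_eq_image_lineMap]; exact isCompact_Icc.image (by fun_prop))
    (convex_segment c d)
    (by rw [segment_eq_image_lineMap]; exact (isCompact_Icc.image (by fun_prop)).isClosed) h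
  -- Every real-linear functional on ℂ has the form z ↦ Re (kz), with this k.
  refine ⟨⟨f 1, -f I⟩, fun z hz w hw => ?_⟩
  have key : ∀ z : ℂ, f z = f 1 * z.re + f I * z.im := by
    intro z
    have : z = z.re • (1 : ℂ) + z.im • I := by
      apply Complex.ext <;> simp
    conv_lhs => rw [this]
    rw [map_add, map_smul, map_smul, smul_eq_mul, smul_eq_mul]; ring
  have h1 := hu z hz
  have h2 := hv w hw
  have h3 := key (w - z)
  rw [map_sub] at h3
  rw [mul_re]
  simp only
  linarith

/-- Both sides are the rotation of a chord from direction c - a to direction d - b, moving one end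
first or the other. They agree exactly because a separating line keeps all four chord directions in
one half-plane. -/
theorem sight_add_sight_of_disjoint {a b c d : ℂ}
    (h : Disjoint (segment ℝ a b) (segment ℝ c d)) :
    sight a c d + sight d a b = sight c a b + sight b c d := by
  obtain ⟨k, hk⟩ := exists_re_pos_of_disjoint_segment h
  have ha := left_mem_segment ℝ a b
  have hb := right_mem_segment ℝ a b
  have hc := left_mem_segment ℝ c d
  have hd := right_mem_segment ℝ c d
  have e : ∀ u v : ℂ, k * (u - v) = -k * (v - u) := by intros; ring
  unfold sight
  rw [cutArg_div_of_re_pos (hk a ha c hc) (hk a ha d hd),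
    cutArg_div_of_re_pos (hk b hb c hc) (hk b hb d hd),
    cutArg_div_of_re_pos (k := -k) (e d a ▸ hk a ha d hd) (e d b ▸ hk b hb d hd),
    cutArg_div_of_re_pos (k := -k) (e c a ▸ hk a ha c hc) (e c b ▸ hk b hb c hc),
    ← e, ← e, ← e, ← e]
  ring

theorem exists_re_pos_of_div_mem_slitPlane {u v : ℂ} (h : v / u ∈ slitPlane) :
    ∃ k : ℂ, 0 < (k * u).re ∧ 0 < (k * v).re := by
  have hu : u ≠ 0 := by rintro rfl; simp at h
  set r := v / u with hr
  have hr0 : r ≠ 0 := slitPlane_ne_zero h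
  have h1 : -Real.pi < r.arg ∧ r.arg < Real.pi :=
    ⟨neg_pi_lt_arg r, (arg_le_pi r).lt_of_ne (mem_slitPlane_iff_arg.1 h).1⟩
  have hcos : 0 < Real.cos (r.arg / 2) :=
    Real.cos_pos_of_mem_Ioo ⟨by linarith, by linarith⟩
  have hv : v = r * u := by rw [hr]; field_simp
  -- This k turns the bisector of the angle from u to v to the positive real axis.
  refine ⟨exp ((-(r.arg / 2) : ℝ) * I) * u⁻¹, ?_, ?_⟩
  · rw [mul_assoc, inv_mul_cancel₀ hu, mul_one, exp_ofReal_mul_I_re, Real.cos_neg]; exact hcos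
  · have : exp ((-(r.arg / 2) : ℝ) * I) * u⁻¹ * v = (‖r‖ : ℝ) * exp ((r.arg / 2 : ℝ) * I) := by
      have e1 : exp ((-(r.arg / 2) : ℝ) * I) * exp (r.arg * I) = exp ((r.arg / 2 : ℝ) * I) := by
        rw [← exp_add]; congr 1; push_cast; ring
      rw [hv, mul_assoc, ← mul_assoc u⁻¹, mul_comm u⁻¹ r, mul_assoc r, inv_mul_cancel₀ hu, mul_one]
      rw [← e1]
      linear_combination -exp ((-(r.arg / 2) : ℝ) * I) * norm_mul_exp_arg_mul_I r
    rw [this, re_ofReal_mul, exp_ofReal_mul_I_re]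
    exact mul_pos (norm_pos_iff.2 hr0) hcos

/-- The exterior angle of a triangle is the sum of the two opposite interior angles; the direction c
- a lies in the half-plane spanned around b - a and c - b. -/
theorem sight_add_sight_eq_turnAngle {a b c : ℂ} (h : (c - b) / (b - a) ∈ slitPlane) :
    sight a b c + sight c a b = turnAngle a b c := by
  obtain ⟨k, h1, h2⟩ := exists_re_pos_of_div_mem_slitPlane h
  have h3 : 0 < (k * (c - a)).re := by
    have : k * (c - a) = k * (b - a) + k * (c - b) := by ring
    rw [this, add_re]; linarith
  have e : ∀ u v : ℂ, k * (u - v) = -k * (v - u) := by intros; ring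
  rw [turnAngle, ← cutArg_of_mem_slitPlane h]
  unfold sight
  rw [cutArg_div_of_re_pos h1 h2, cutArg_div_of_re_pos h1 h3,
    cutArg_div_of_re_pos (k := -k) (e c a ▸ h3) (e c b ▸ h2), ← e, ← e]
  ring

/-! ### Total turning and the loop seen from its base point -/

namespace IsSimpleLoop

variable {m : ℕ} {q : ℕ → ℂ}

/-- The exchange identity for disjoint segments, summed over the sides j from i + 2 on; the sights
of side i telescope. `hi` excludes the pair of the first and the last side, which share a vertex. -/
theorem sum_sight_add_sight (h : IsSimpleLoop m q) (i n : ℕ) (hn : i + 2 + n ≤ m + 1)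
    (hi : i ≠ 0 ∨ i + 2 + n ≠ m + 1) :
    ∑ j ∈ Finset.Ico (i + 2) (i + 2 + n), sight (q i) (q j) (q (j + 1)) +
        sight (q (i + 2 + n)) (q i) (q (i + 1)) =
      sight (q (i + 2)) (q i) (q (i + 1)) +
        ∑ j ∈ Finset.Ico (i + 2) (i + 2 + n), sight (q (i + 1)) (q j) (q (j + 1)) := by
  induction n with
  | zero => simp
  | succ n ih =>
    have ih' := ih (by omega) (by omega)
    have c := sight_add_sight_of_disjoint (h.disj i (i + 2 + n) (by omega) (by omega) (by omega))
    rw [← add_assoc, Finset.sum_Ico_succ_top (by omega), Finset.sum_Ico_succ_top (by omega)]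
    linarith

/-- The angle under which a simple closed polygonal line is seen from one of its vertices,
computed from its total turning. -/
theorem two_mul_sum_sight (h : IsSimpleLoop m q) :
    2 * ∑ j ∈ Finset.Ico 1 m, sight (q 0) (q j) (q (j + 1)) =
      totalTurn m q - 2 * turnAngle (q m) (q 0) (q 1) := by
  have hm := h.two_le
  -- The left side is the rotation of the chord from `q i` whose far end runs from `q (i + 1)` along
  -- the loop to `q 0`. Moving its near end to `q (i + 1)` produces the exterior angle there and the
  -- sight of side i from `q 0`.
  have step : ∀ i, 1 ≤ i → i < m →
      ∑ j ∈ Finset.Ico (i + 1) (m + 1), sight (q i) (q j) (q (j + 1)) =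
        (turnAngle (q i) (q (i + 1)) (q (i + 2)) - sight (q 0) (q i) (q (i + 1))) +
        ∑ j ∈ Finset.Ico (i + 1 + 1) (m + 1), sight (q (i + 1)) (q j) (q (j + 1)) := by
    intro i hi him
    have t := sight_add_sight_eq_turnAngle (h.turn i him)
    obtain ⟨n, hn⟩ : ∃ n, i + 2 + n = m + 1 := ⟨m - 1 - i, by omega⟩
    have s := h.sum_sight_add_sight i n hn.le (by omega)
    rw [hn, h.closed] at s
    rw [Finset.sum_eq_sum_Ico_succ_bot (by omega)]
    linarith
  have total : ∀ n, 1 ≤ n → n ≤ m →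
      ∑ j ∈ Finset.Ico 2 (m + 1), sight (q 1) (q j) (q (j + 1)) =
        ∑ i ∈ Finset.Ico 1 n,
          (turnAngle (q i) (q (i + 1)) (q (i + 2)) - sight (q 0) (q i) (q (i + 1))) +
        ∑ j ∈ Finset.Ico (n + 1) (m + 1), sight (q n) (q j) (q (j + 1)) := by
    intro n hn
    induction n, hn using Nat.le_induction with
    | base => intro _; simp
    | succ n hn ih =>
      intro hnm
      rw [ih (by omega), step n hn (by omega), Finset.sum_Ico_succ_top hn]
      ring
  have t1 := total m (by omega) le_rfl
  rw [Finset.Ico_self, Finset.sum_empty, add_zero, Finset.sum_sub_distrib,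
    Finset.sum_Ico_succ_top hm, h.closed] at t1
  have t2 := sight_add_sight_eq_turnAngle (h.turn 0 (by omega))
  have t3 := sight_add_sight_eq_turnAngle h.turn_last
  -- The chords from `q 0` and `q 1` are compared only up to side m - 1, because side m meets side
  -- 0; `t3` treats that corner. Here the sights from `q 0` enter a second time, whence the factor
  -- two.
  obtain ⟨n, hn⟩ : ∃ n, 0 + 2 + n = m := ⟨m - 2, by omega⟩
  have s := h.sum_sight_add_sight 0 n (by omega) (by omega)
  rw [hn] at s
  have e1 : ∑ j ∈ Finset.Ico 1 m, sight (q 0) (q j) (q (j + 1)) =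
      sight (q 0) (q 1) (q 2) + ∑ j ∈ Finset.Ico 2 m, sight (q 0) (q j) (q (j + 1)) :=
    Finset.sum_eq_sum_Ico_succ_bot (by omega) _
  have e2 : totalTurn m q = turnAngle (q 0) (q 1) (q 2) +
      ∑ i ∈ Finset.Ico 1 m, turnAngle (q i) (q (i + 1)) (q (i + 2)) +
      turnAngle (q m) (q 0) (q 1) := by
    rw [totalTurn, Finset.range_eq_Ico, Finset.sum_eq_sum_Ico_succ_bot (by omega)]
  simp only [zero_add] at s t2
  linarith

end IsSimpleLoop

/-! ### The winding angle off the loop -/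

/-- The closed polygonal line with sides from `q i` to `q (i + 1)`, where `i ≤ m`. -/
def loopTrace (m : ℕ) (q : ℕ → ℂ) : Set ℂ := {z | ∃ i ≤ m, z ∈ segment ℝ (q i) (q (i + 1))}

/-- The total oriented angle under which a polygonal line is seen from `x`. -/
noncomputable def windingAngle (m : ℕ) (q : ℕ → ℂ) (x : ℂ) : ℝ :=
  ∑ i ∈ Finset.range (m + 1), sight x (q i) (q (i + 1))

/-- A quotient r outside the slit plane is a real number r ≤ 0, and b - x = r (a - x) exhibits x as
a convex combination of a and b. Off the segment, `sight` therefore avoids the branch cut and is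
continuous. -/
theorem div_mem_slitPlane_of_notMem_segment {x a b : ℂ} (h : x ∉ segment ℝ a b) :
    (b - x) / (a - x) ∈ slitPlane := by
  by_contra hs
  rw [mem_slitPlane_iff, not_or, not_lt, not_not] at hs
  have hax : a - x ≠ 0 := by
    intro h'
    exact h (by rw [← sub_eq_zero.1 h']; exact left_mem_segment ℝ _ _)
  set r := ((b - x) / (a - x)).re with hr
  have e : (b - x) / (a - x) = (r : ℂ) := Complex.ext (by simp [hr]) (by simp [hs.2])
  rw [div_eq_iff hax] at e
  have hr1 : (1 : ℝ) - r ≠ 0 := by linarith [hs.1]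
  have hr1' : (1 : ℂ) - r ≠ 0 := by exact_mod_cast hr1
  apply h
  refine ⟨-r / (1 - r), 1 / (1 - r), div_nonneg (by linarith [hs.1]) (by linarith [hs.1]),
    div_nonneg (by linarith [hs.1]) (by linarith [hs.1]), by field_simp; ring, ?_⟩
  simp only [real_smul]
  push_cast
  field_simp
  linear_combination e

theorem isClosed_segment_complex (a b : ℂ) : IsClosed (segment ℝ a b) := by
  rw [segment_eq_image_lineMap]; exact (isCompact_Icc.image (by fun_prop)).isClosed

theorem isCompact_segment_complex (a b : ℂ) : IsCompact (segment ℝ a b) := by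
  rw [segment_eq_image_lineMap]; exact (isCompact_Icc.image (by fun_prop))

theorem continuousAt_cutArg {z : ℂ} (h : z ∈ slitPlane) : ContinuousAt cutArg z := by
  refine (continuousAt_arg h).congr ?_
  filter_upwards [isOpen_slitPlane.mem_nhds h] with w hw
  rw [cutArg_of_mem_slitPlane hw]

theorem continuousAt_sight {x a b : ℂ} (h : x ∉ segment ℝ a b) :
    ContinuousAt (fun y => sight y a b) x := by
  have hax : a - x ≠ 0 := by
    intro h'
    exact h (by rw [← sub_eq_zero.1 h']; exact left_mem_segment ℝ _ _)
  unfold sight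
  have h1 : ContinuousAt (fun y => (b - y) / (a - y)) x :=
    ContinuousAt.div (by fun_prop) (by fun_prop) hax
  exact ContinuousAt.comp (g := cutArg) (continuousAt_cutArg (div_mem_slitPlane_of_notMem_segment h)) h1

theorem continuousAt_windingAngle {m : ℕ} {q : ℕ → ℂ} {x : ℂ} (h : x ∉ loopTrace m q) :
    ContinuousAt (windingAngle m q) x := by
  unfold windingAngle
  refine tendsto_finsetSum _ fun i hi => continuousAt_sight fun hx => h ⟨i, ?_, hx⟩
  have := Finset.mem_range.1 hi
  omega

theorem coe_sight {x a b : ℂ} (h : x ∉ segment ℝ a b) :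
    (sight x a b : Real.Angle) = (b - x).arg - (a - x).arg := by
  rw [sight, cutArg_of_mem_slitPlane (div_mem_slitPlane_of_notMem_segment h), arg_div_coe_angle]
  · intro h'
    exact h (by rw [← sub_eq_zero.1 h']; exact right_mem_segment ℝ _ _)
  · intro h'
    exact h (by rw [← sub_eq_zero.1 h']; exact left_mem_segment ℝ _ _)

/-- Modulo 2π each sight is a difference of arguments, and the sum around the closed line telescopes
to 0. -/
theorem exists_windingAngle_eq {m : ℕ} {q : ℕ → ℂ} (hq : q (m + 1) = q 0) {x : ℂ}
    (h : x ∉ loopTrace m q) : ∃ n : ℤ, windingAngle m q x = n * (2 * Real.pi) := by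
  have : (windingAngle m q x : Real.Angle) = 0 := by
    have e : (windingAngle m q x : Real.Angle) =
        ∑ i ∈ Finset.range (m + 1), (sight x (q i) (q (i + 1)) : Real.Angle) :=
      map_sum Real.Angle.coeHom _ _
    rw [e, Finset.sum_congr rfl (g := fun i => ((q (i + 1) - x).arg : Real.Angle) - (q i - x).arg),
      Finset.sum_range_sub (fun i => ((q i - x).arg : Real.Angle)), hq, sub_self]
    intro i hi
    refine coe_sight fun hx => h ⟨i, ?_, hx⟩
    have := Finset.mem_range.1 hi
    omega
  obtain ⟨n, hn⟩ := Real.Angle.coe_eq_zero_iff.1 this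
  exact ⟨n, by rw [← hn, zsmul_eq_mul]⟩

/-- The winding angle is continuous off the line with values in 2πℤ. If two values differed, the
intermediate value theorem would yield a value halfway between two consecutive multiples of 2π. -/
theorem windingAngle_eq_of_isPreconnected {m : ℕ} {q : ℕ → ℂ} (hq : q (m + 1) = q 0) {S : Set ℂ}
    (hS : IsPreconnected S) (hSt : S ⊆ (loopTrace m q)ᶜ) {x y : ℂ} (hx : x ∈ S) (hy : y ∈ S) :
    windingAngle m q x = windingAngle m q y := by
  have main : ∀ {x y : ℂ}, x ∈ S → y ∈ S → ¬ windingAngle m q x < windingAngle m q y := by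
    intro x y hx hy hlt
    obtain ⟨n, hn⟩ := exists_windingAngle_eq hq (hSt hx)
    obtain ⟨k, hk⟩ := exists_windingAngle_eq hq (hSt hy)
    have hpi := Real.pi_pos
    rw [hn, hk] at hlt
    have hnk : (n : ℝ) < k := lt_of_mul_lt_mul_right hlt (by positivity)
    have hnk' : (n : ℝ) + 1 ≤ k := by exact_mod_cast hnk
    obtain ⟨z, hz, hzv⟩ := hS.intermediate_value hx hy
      (fun z hz => (continuousAt_windingAngle (hSt hz)).continuousWithinAt)
      (show ((n : ℝ) + 1 / 2) * (2 * Real.pi) ∈ Set.Icc _ _ by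
        rw [hn, hk]; constructor <;> nlinarith)
    obtain ⟨l, hl⟩ := exists_windingAngle_eq hq (hSt hz)
    have h2 : (l : ℝ) = n + 1 / 2 := by
      have := hl.symm.trans hzv
      exact mul_right_cancel₀ (by positivity) this
    have h3 : (2 * l : ℤ) = 2 * n + 1 := by
      have : (2 * l : ℝ) = 2 * n + 1 := by linarith
      exact_mod_cast this
    omega
  exact le_antisymm (not_lt.1 (main hy hx)) (not_lt.1 (main hx hy))

theorem windingAngle_eq_zero {m : ℕ} {q : ℕ → ℂ} (hq : q (m + 1) = q 0) {x k : ℂ}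
    (h : ∀ i ≤ m, 0 < (k * (q i - x)).re) : windingAngle m q x = 0 := by
  have h' : ∀ i ≤ m + 1, 0 < (k * (q i - x)).re := by
    intro i hi
    rcases Nat.lt_or_ge m i with h1 | h1
    · obtain rfl : i = m + 1 := by omega
      rw [hq]; exact h 0 (Nat.zero_le _)
    · exact h i h1
  unfold windingAngle
  rw [Finset.sum_congr rfl (g := fun i => (k * (q (i + 1) - x)).arg - (k * (q i - x)).arg),
    Finset.sum_range_sub (fun i => (k * (q i - x)).arg), hq, sub_self]
  intro i hi
  have := Finset.mem_range.1 hi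
  exact cutArg_div_of_re_pos (h' i (by omega)) (h' (i + 1) (by omega))

/-! ### The two sides of the loop at its base point -/

theorem eq_of_mem_segment_of_mem_segment {a b c z : ℂ} (h : (c - b) / (b - a) ∈ slitPlane)
    (h1 : z ∈ segment ℝ a b) (h2 : z ∈ segment ℝ b c) : z = b := by
  have hab : b - a ≠ 0 := by intro h'; simp [h'] at h
  rw [segment_eq_image'] at h1 h2
  obtain ⟨s, hs, rfl⟩ := h1
  obtain ⟨t, ht, h2⟩ := h2
  simp only [real_smul] at h2 ⊢
  rcases ht.1.eq_or_lt with h0 | h0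
  · rw [← h2, ← h0]; simp
  · exfalso
    have h0' : (t : ℂ) ≠ 0 := by exact_mod_cast h0.ne'
    have : (c - b) / (b - a) = ((-(1 - s) / t : ℝ) : ℂ) := by
      rw [div_eq_iff hab]; push_cast; field_simp
      linear_combination h2
    rw [this, ofReal_mem_slitPlane] at h
    have : -(1 - s) / t ≤ 0 := div_nonpos_of_nonpos_of_nonneg (by linarith [hs.2]) h0.le
    linarith

theorem eq_zero_of_mul_exp_eq {r s θ : ℝ} (hr : 0 < r) (hs : 0 ≤ s) (h1 : -(2 * Real.pi) < θ)
    (h2 : θ < 2 * Real.pi) (h : (r : ℂ) * exp (θ * I) = s) : θ = 0 := by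
  have him := congrArg Complex.im h
  have hre := congrArg Complex.re h
  rw [im_ofReal_mul, exp_ofReal_mul_I_im, ofReal_im] at him
  rw [re_ofReal_mul, exp_ofReal_mul_I_re, ofReal_re] at hre
  have hsin : Real.sin θ = 0 := by
    rcases mul_eq_zero.1 him with h | h
    · exact absurd h hr.ne'
    · exact h
  have hcos : 0 ≤ Real.cos θ := by
    by_contra hc
    nlinarith
  have hcos1 : Real.cos θ = 1 := by
    have := Real.sin_sq_add_cos_sq θ
    rw [hsin] at this
    nlinarith
  exact (Real.cos_eq_one_iff_of_lt_of_lt h1 h2).1 hcos1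

theorem arg_mul_exp_mul_I {r ψ : ℝ} (hr : 0 < r) (h1 : -Real.pi < ψ) (h2 : ψ < Real.pi) :
    ((r : ℂ) * exp (ψ * I)).arg = ψ := by
  rw [arg_real_mul _ hr, arg_exp_mul_I, toIocMod_eq_self]
  constructor <;> linarith

theorem mul_exp_mul_I_mem_slitPlane {r ψ : ℝ} (hr : 0 < r) (h1 : -Real.pi < ψ)
    (h2 : ψ < Real.pi) : (r : ℂ) * exp (ψ * I) ∈ slitPlane := by
  rw [mem_slitPlane_iff_arg, arg_mul_exp_mul_I hr h1 h2]
  exact ⟨h2.ne, mul_ne_zero (by exact_mod_cast hr.ne') (exp_ne_zero _)⟩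

theorem cutArg_real_mul {r : ℝ} (hr : 0 < r) (z : ℂ) : cutArg (r * z) = cutArg z := by
  rw [cutArg, cutArg, arg_real_mul _ hr]

/-- The open sector at `y` of radius `δ ‖e‖`, between the directions of angle `α` and `β` measured
from the direction of `e`. -/
def planeSector (y e : ℂ) (δ α β : ℝ) : Set ℂ :=
  {z | ∃ r ∈ Set.Ioo 0 δ, ∃ θ ∈ Set.Ioo α β, z = y + (r : ℂ) * exp ((θ : ℂ) * I) * e}

theorem isPreconnected_planeSector (y e : ℂ) (δ α β : ℝ) :
    IsPreconnected (planeSector y e δ α β) := by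
  have : planeSector y e δ α β = (fun p : ℝ × ℝ => y + (p.1 : ℂ) * exp ((p.2 : ℂ) * I) * e) ''
      (Set.Ioo 0 δ ×ˢ Set.Ioo α β) := by
    ext z
    constructor
    · rintro ⟨r, hr, θ, hθ, rfl⟩
      exact ⟨(r, θ), ⟨hr, hθ⟩, rfl⟩
    · rintro ⟨⟨r, θ⟩, ⟨hr, hθ⟩, rfl⟩
      exact ⟨r, hr, θ, hθ, rfl⟩
  rw [this]
  exact (isPreconnected_Ioo.prod isPreconnected_Ioo).image _ (by fun_prop)

theorem mem_closure_planeSector (y e : ℂ) {δ α β : ℝ} (hδ : 0 < δ) (hαβ : α < β) :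
    y ∈ closure (planeSector y e δ α β) := by
  have ht : Filter.Tendsto (fun r : ℝ => y + (r : ℂ) * exp ((((α + β) / 2 : ℝ) : ℂ) * I) * e)
      (nhdsWithin 0 (Set.Ioi 0)) (nhds y) := by
    have : Continuous (fun r : ℝ => y + (r : ℂ) * exp ((((α + β) / 2 : ℝ) : ℂ) * I) * e) := by
      fun_prop
    have h := this.tendsto 0
    simp only [ofReal_zero, zero_mul, add_zero] at h
    exact h.mono_left nhdsWithin_le_nhds
  refine mem_closure_of_tendsto ht ?_
  filter_upwards [Ioo_mem_nhdsGT hδ] with r hr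
  exact ⟨r, hr, (α + β) / 2, ⟨by linarith, by linarith⟩, rfl⟩

namespace IsSimpleLoop

variable {m : ℕ} {q : ℕ → ℂ}

theorem notMem_segment (h : IsSimpleLoop m q) {i : ℕ} (hi : 1 ≤ i) (him : i < m) :
    q 0 ∉ segment ℝ (q i) (q (i + 1)) := by
  have h0 := left_mem_segment ℝ (q 0) (q 1)
  intro hx
  rcases hi.eq_or_lt with rfl | hi
  · have ht := h.turn 0 (by omega)
    have := eq_of_mem_segment_of_mem_segment ht h0 hx
    simp only [zero_add] at this ht
    rw [this] at ht
    simp at ht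
  · exact Set.disjoint_left.1 (h.disj 0 i (by omega) him.le (Or.inr him.ne)) h0 hx

theorem sub_ne_zero (h : IsSimpleLoop m q) : q 1 - q 0 ≠ 0 := by
  intro h'
  have := h.turn_last
  rw [h'] at this
  simp at this

theorem sub_last_ne_zero (h : IsSimpleLoop m q) : q 0 - q m ≠ 0 := by
  intro h'
  have := h.turn_last
  rw [h'] at this
  simp at this

theorem turn_mem_Ioo (h : IsSimpleLoop m q) :
    turnAngle (q m) (q 0) (q 1) ∈ Set.Ioo (-Real.pi) Real.pi :=
  ⟨neg_pi_lt_arg _, (arg_le_pi _).lt_of_ne (mem_slitPlane_iff_arg.1 h.turn_last).1⟩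

/-- The last side in terms of the first one. -/
theorem exists_sub_last (h : IsSimpleLoop m q) : ∃ ρ : ℝ, 0 < ρ ∧
    q 0 - q m = -((ρ : ℂ) * exp ((Real.pi - turnAngle (q m) (q 0) (q 1) : ℝ) * I) * (q 1 - q 0)) ∧
    (q 1 - q 0) / (q 0 - q m) = (ρ⁻¹ : ℝ) * exp ((turnAngle (q m) (q 0) (q 1) : ℝ) * I) := by
  have h0 := h.sub_ne_zero
  have h1 := h.sub_last_ne_zero
  set z := (q 1 - q 0) / (q 0 - q m) with hz
  have hz0 : z ≠ 0 := div_ne_zero h0 h1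
  have hn : ‖z‖ ≠ 0 := norm_ne_zero_iff.2 hz0
  have e := norm_mul_exp_arg_mul_I z
  have ht : turnAngle (q m) (q 0) (q 1) = z.arg := rfl
  refine ⟨‖z‖⁻¹, by positivity, ?_, ?_⟩
  · have e1 : q 1 - q 0 = z * (q 0 - q m) := by rw [hz]; field_simp
    have e2 : exp ((Real.pi - z.arg : ℝ) * I) * exp (z.arg * I) = -1 := by
      rw [← exp_add, ← exp_pi_mul_I]; congr 1; push_cast; ring
    have hnc : (‖z‖ : ℂ) ≠ 0 := by exact_mod_cast hn
    rw [ht, e1]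
    push_cast at e2 ⊢
    have e3 : z * ((‖z‖ : ℂ))⁻¹ = exp (z.arg * I) := by
      rw [← div_eq_mul_inv, div_eq_iff hnc, mul_comm, e]
    linear_combination (q 0 - q m) * (e2 + exp ((Real.pi - z.arg) * I) * e3)
  · rw [inv_inv, ht, e]

theorem notMem_first_segment (h : IsSimpleLoop m q) {r θ : ℝ} (hr : 0 < r) (h0 : 0 < θ)
    (h1 : θ < 2 * Real.pi) :
    q 0 + (r : ℂ) * exp ((θ : ℂ) * I) * (q 1 - q 0) ∉ segment ℝ (q 0) (q 1) := by
  rw [segment_eq_image']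
  rintro ⟨s, hs, hx⟩
  have : (r : ℂ) * exp ((θ : ℂ) * I) = s := by
    apply mul_right_cancel₀ h.sub_ne_zero
    simp only [real_smul] at hx
    linear_combination -hx
  have := eq_zero_of_mul_exp_eq hr hs.1 (by linarith) h1 this
  linarith

theorem notMem_last_segment (h : IsSimpleLoop m q) {r θ : ℝ} (hr : 0 < r) (h0 : 0 < θ)
    (h1 : θ < 2 * Real.pi) (hθ : θ ≠ Real.pi - turnAngle (q m) (q 0) (q 1)) :
    q 0 + (r : ℂ) * exp ((θ : ℂ) * I) * (q 1 - q 0) ∉ segment ℝ (q m) (q 0) := by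
  rw [segment_symm, segment_eq_image']
  rintro ⟨s, hs, hx⟩
  obtain ⟨ρ, hρ, e, -⟩ := h.exists_sub_last
  obtain ⟨ht1, ht2⟩ := h.turn_mem_Ioo
  set φ := Real.pi - turnAngle (q m) (q 0) (q 1) with hφ
  have e2 : (r : ℂ) * exp ((θ : ℂ) * I) = (s * ρ : ℝ) * exp ((φ : ℂ) * I) := by
    apply mul_right_cancel₀ h.sub_ne_zero
    simp only [real_smul] at hx
    push_cast
    linear_combination -hx - s * e
  have e3 : (r : ℂ) * exp ((θ - φ : ℝ) * I) = (s * ρ : ℝ) := by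
    have : exp ((θ - φ : ℝ) * I) = exp ((θ : ℂ) * I) * exp (-((φ : ℂ) * I)) := by
      rw [← exp_add]; congr 1; push_cast; ring
    rw [this, ← mul_assoc, e2, mul_assoc, ← exp_add]
    simp
  have := eq_zero_of_mul_exp_eq hr (mul_nonneg hs.1 hρ.le) (by linarith) (by linarith) e3
  exact hθ (by linarith)

/-- Near its base point, the complement of the line consists of two sectors. -/
theorem exists_radius (h : IsSimpleLoop m q) : ∃ ε > 0, ∃ δ > 0,
    (∀ α β, 0 ≤ α → β ≤ 2 * Real.pi →
      (β ≤ Real.pi - turnAngle (q m) (q 0) (q 1) ∨ Real.pi - turnAngle (q m) (q 0) (q 1) ≤ α) →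
      planeSector (q 0) (q 1 - q 0) δ α β ⊆ (loopTrace m q)ᶜ) ∧
    Metric.ball (q 0) ε \ loopTrace m q ⊆
      planeSector (q 0) (q 1 - q 0) δ 0 (Real.pi - turnAngle (q m) (q 0) (q 1)) ∪
      planeSector (q 0) (q 1 - q 0) δ (Real.pi - turnAngle (q m) (q 0) (q 1)) (2 * Real.pi) := by
  have hm := h.two_le
  have h0 := h.sub_ne_zero
  have h1 := h.sub_last_ne_zero
  have hn0 := norm_pos_iff.2 h0
  have hn1 := norm_pos_iff.2 h1
  obtain ⟨ht1, ht2⟩ := h.turn_mem_Ioo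
  have hclosed : IsClosed (⋃ i ∈ Finset.Ico 1 m, segment ℝ (q i) (q (i + 1))) :=
    isClosed_biUnion_finset fun i _ => isClosed_segment_complex _ _
  have hmem : (⋃ i ∈ Finset.Ico 1 m, segment ℝ (q i) (q (i + 1)))ᶜ ∈ nhds (q 0) := by
    refine hclosed.isOpen_compl.mem_nhds ?_
    simp only [Set.mem_compl_iff, Set.mem_iUnion, not_exists, Finset.mem_Ico]
    exact fun i hi => h.notMem_segment hi.1 hi.2
  obtain ⟨ε₀, hε₀, hball⟩ := Metric.mem_nhds_iff.1 hmem
  -- The ball misses the sides not at `q 0`, and neither of the two sides at `q 0` ends inside it.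
  set ε := min ε₀ (min ‖q 1 - q 0‖ ‖q 0 - q m‖) with hε
  have hεpos : 0 < ε := by positivity
  -- Looking back from `q 0`, the last side leaves at the angle φ from the first one, so the sectors
  -- are (0, φ) and (φ, 2π). Their radii are measured in units of ‖q 1 - q 0‖.
  set φ := Real.pi - turnAngle (q m) (q 0) (q 1) with hφ
  refine ⟨ε, hεpos, ε / ‖q 1 - q 0‖, by positivity, ?_, ?_⟩
  · rintro α β hα hβ hαβ _ ⟨r, hr, θ, hθ, rfl⟩ ⟨i, him, hi⟩
    have hθ0 : 0 < θ := hα.trans_lt hθ.1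
    have hθ1 : θ < 2 * Real.pi := hθ.2.trans_le hβ
    have hθφ : θ ≠ φ := by
      rcases hαβ with h' | h'
      · exact (hθ.2.trans_le h').ne
      · exact (h'.trans_lt hθ.1).ne'
    rcases Nat.eq_zero_or_pos i with rfl | hi0
    · exact h.notMem_first_segment hr.1 hθ0 hθ1 hi
    rcases him.eq_or_lt with rfl | him
    · rw [h.closed] at hi
      exact h.notMem_last_segment hr.1 hθ0 hθ1 hθφ hi
    · have hb : q 0 + (r : ℂ) * exp ((θ : ℂ) * I) * (q 1 - q 0) ∈ Metric.ball (q 0) ε₀ := by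
        rw [Metric.mem_ball, dist_eq, add_sub_cancel_left, norm_mul, norm_mul,
          norm_exp_ofReal_mul_I, norm_real, Real.norm_of_nonneg hr.1.le, mul_one]
        exact ((lt_div_iff₀ hn0).1 hr.2).trans_le (min_le_left _ _)
      have := hball hb
      simp only [Set.mem_compl_iff, Set.mem_iUnion, not_exists, Finset.mem_Ico] at this
      exact this i ⟨hi0, him⟩ hi
  · rintro x ⟨hxb, hxt⟩
    have hx0 : x - q 0 ≠ 0 := by
      intro h'
      refine hxt ⟨0, by omega, ?_⟩
      rw [sub_eq_zero.1 h']
      exact left_mem_segment ℝ _ _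
    rw [Metric.mem_ball, dist_eq] at hxb
    set z := (x - q 0) / (q 1 - q 0) with hz
    have hz0 : z ≠ 0 := div_ne_zero hx0 h0
    have hzn : 0 < ‖z‖ := norm_pos_iff.2 hz0
    have hxz : x = q 0 + z * (q 1 - q 0) := by rw [hz]; field_simp; ring
    have hzr : ‖z‖ < ε / ‖q 1 - q 0‖ := by
      rw [hz, norm_div]; gcongr
    have hzle : ‖z‖ ≤ 1 := by
      refine hzr.le.trans ?_
      rw [div_le_one hn0]
      exact (min_le_right _ _).trans (min_le_left _ _)
    obtain ⟨θ, hθ0, hθ1, hθ⟩ : ∃ θ : ℝ, 0 < θ ∧ θ ≤ 2 * Real.pi ∧ z = ‖z‖ * exp (θ * I) := by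
      have h2 := neg_pi_lt_arg z
      have h3 := arg_le_pi z
      rcases lt_or_ge 0 z.arg with h4 | h4
      · exact ⟨z.arg, h4, by linarith, (norm_mul_exp_arg_mul_I z).symm⟩
      · refine ⟨z.arg + 2 * Real.pi, by linarith, by linarith, ?_⟩
        push_cast
        rw [add_mul, exp_add, exp_two_pi_mul_I, mul_one, norm_mul_exp_arg_mul_I]
    have hθ2 : θ ≠ 2 * Real.pi := by
      rintro rfl
      refine hxt ⟨0, by omega, ?_⟩
      push_cast at hθ
      rw [exp_two_pi_mul_I, mul_one] at hθ
      rw [segment_eq_image']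
      refine ⟨‖z‖, ⟨hzn.le, hzle⟩, ?_⟩
      simp only [real_smul, zero_add]
      rw [← hθ, ← hxz]
    have hθφ : θ ≠ φ := by
      rintro rfl
      obtain ⟨ρ, hρ, e, -⟩ := h.exists_sub_last
      rw [← hφ] at e
      refine hxt ⟨m, le_rfl, ?_⟩
      have hρc : (ρ : ℂ) ≠ 0 := by exact_mod_cast hρ.ne'
      have hen : ‖q 0 - q m‖ = ρ * ‖q 1 - q 0‖ := by
        rw [e, norm_neg, norm_mul, norm_mul, norm_exp_ofReal_mul_I, norm_real,
          Real.norm_of_nonneg hρ.le, mul_one]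
      rw [h.closed, segment_symm, segment_eq_image']
      refine ⟨‖z‖ / ρ, ⟨by positivity, ?_⟩, ?_⟩
      · rw [div_le_one hρ]
        have h5 : ε ≤ ρ * ‖q 1 - q 0‖ := by
          rw [← hen]; exact (min_le_right _ _).trans (min_le_right _ _)
        refine hzr.le.trans ?_
        rw [div_le_iff₀ hn0]; exact h5
      · simp only [real_smul]
        rw [hxz, hθ]
        push_cast
        have : q m - q 0 = (ρ : ℂ) * exp ((φ : ℝ) * I) * (q 1 - q 0) := by
          linear_combination -e
        rw [this, norm_mul, norm_exp_ofReal_mul_I]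
        simp
        field_simp
    have hxz' : x = q 0 + ((‖z‖ : ℝ) : ℂ) * exp ((θ : ℂ) * I) * (q 1 - q 0) := by
      rw [← hθ, ← hxz]
    rcases lt_or_gt_of_ne hθφ with h6 | h6
    · exact Or.inl ⟨‖z‖, ⟨hzn, hzr⟩, θ, ⟨hθ0, h6⟩, hxz'⟩
    · exact Or.inr ⟨‖z‖, ⟨hzn, hzr⟩, θ, ⟨h6, hθ1.lt_of_ne hθ2⟩, hxz'⟩

/-- The limit at the base point of the winding angle along a ray of direction `θ`; here `ψ` is the
angle of the ray with the last side. -/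
theorem tendsto_windingAngle (h : IsSimpleLoop m q) {θ ψ : ℝ} (h0 : 0 < θ)
    (h1 : θ < 2 * Real.pi) (hψ1 : -Real.pi < ψ) (hψ2 : ψ < Real.pi)
    (hψ : exp ((ψ : ℂ) * I) = exp ((θ + turnAngle (q m) (q 0) (q 1) : ℝ) * I)) :
    Filter.Tendsto
      (fun r : ℝ => windingAngle m q (q 0 + (r : ℂ) * exp ((θ : ℂ) * I) * (q 1 - q 0)))
      (nhdsWithin 0 (Set.Ioi 0))
      (nhds (totalTurn m q / 2 - turnAngle (q m) (q 0) (q 1) + (Real.pi - θ) + ψ)) := by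
  have hm := h.two_le
  have he0 := h.sub_ne_zero
  have he1 := h.sub_last_ne_zero
  set u := exp ((θ : ℂ) * I) * (q 1 - q 0) with hu
  have hu0 : u ≠ 0 := mul_ne_zero (exp_ne_zero _) he0
  have hx : Filter.Tendsto (fun r : ℝ => q 0 + (r : ℂ) * exp ((θ : ℂ) * I) * (q 1 - q 0))
      (nhdsWithin 0 (Set.Ioi 0)) (nhds (q 0)) := by
    have : Continuous (fun r : ℝ => q 0 + (r : ℂ) * exp ((θ : ℂ) * I) * (q 1 - q 0)) := by
      fun_prop
    have h := this.tendsto 0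
    simp only [ofReal_zero, zero_mul, add_zero] at h
    exact h.mono_left nhdsWithin_le_nhds
  have split : ∀ x, windingAngle m q x = ∑ j ∈ Finset.Ico 1 m, sight x (q j) (q (j + 1)) +
      sight x (q 0) (q 1) + sight x (q m) (q 0) := by
    intro x
    rw [windingAngle, Finset.sum_range_succ, Finset.range_eq_Ico,
      Finset.sum_eq_sum_Ico_succ_bot (by omega), h.closed]
    ring
  have hK : totalTurn m q / 2 - turnAngle (q m) (q 0) (q 1) =
      ∑ j ∈ Finset.Ico 1 m, sight (q 0) (q j) (q (j + 1)) := by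
    have := h.two_mul_sum_sight
    linarith
  simp only [split]
  rw [hK]
  -- The sides away from `q 0` are seen continuously there. The first side is seen in the limit
  -- under the angle π - θ and the last one under ψ.
  refine Filter.Tendsto.add (Filter.Tendsto.add ?_ ?_) ?_
  · refine tendsto_finsetSum _ fun i hi => ?_
    rw [Finset.mem_Ico] at hi
    exact (continuousAt_sight (h.notMem_segment hi.1 hi.2)).tendsto.comp hx
  · have hlim : (q 1 - q 0) / (-u) = (1 : ℝ) * exp ((Real.pi - θ : ℝ) * I) := by
      have e : exp ((Real.pi - θ : ℝ) * I) * exp ((θ : ℂ) * I) = -1 := by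
        rw [← exp_add, ← exp_pi_mul_I]; congr 1; push_cast; ring
      rw [div_eq_iff (neg_ne_zero.2 hu0), hu, ofReal_one]
      linear_combination (q 1 - q 0) * e
    have hs := mul_exp_mul_I_mem_slitPlane (r := 1) (ψ := Real.pi - θ) one_pos (by linarith)
      (by linarith)
    -- A positive factor does not change `cutArg`; once the power of r is removed, the quotient has
    -- a limit in the slit plane, where `cutArg` is continuous.
    have hc : Filter.Tendsto (fun r : ℝ => cutArg ((q 1 - q 0 - r * u) / (-u)))
        (nhdsWithin 0 (Set.Ioi 0)) (nhds (Real.pi - θ)) := by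
      have h2 : ContinuousAt (fun r : ℝ => (q 1 - q 0 - r * u) / (-u)) 0 := by fun_prop
      have h3 : ContinuousAt cutArg ((q 1 - q 0 - (0 : ℝ) * u) / (-u)) := by
        rw [ofReal_zero, zero_mul, sub_zero, hlim]
        exact continuousAt_cutArg hs
      have h4 := (ContinuousAt.comp (f := fun r : ℝ => (q 1 - q 0 - r * u) / (-u)) h3 h2).tendsto
      simp only [Function.comp_def] at h4
      rw [ofReal_zero, zero_mul, sub_zero, hlim, cutArg_of_mem_slitPlane hs,
        arg_mul_exp_mul_I one_pos (by linarith) (by linarith)] at h4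
      exact h4.mono_left nhdsWithin_le_nhds
    refine hc.congr' ?_
    filter_upwards [self_mem_nhdsWithin] with r hr
    rw [Set.mem_Ioi] at hr
    have hrc : (r : ℂ) ≠ 0 := by exact_mod_cast hr.ne'
    rw [sight, ← cutArg_real_mul (inv_pos.2 hr)]
    congr 1
    rw [show q 0 - (q 0 + (r : ℂ) * exp ((θ : ℂ) * I) * (q 1 - q 0)) = r * -u by rw [hu]; ring,
      show q 1 - (q 0 + (r : ℂ) * exp ((θ : ℂ) * I) * (q 1 - q 0)) = q 1 - q 0 - r * u by
        rw [hu]; ring]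
    push_cast
    field_simp
  · obtain ⟨ρ, hρ, -, e⟩ := h.exists_sub_last
    have hlim : u / (q 0 - q m) = (ρ⁻¹ : ℝ) * exp ((ψ : ℝ) * I) := by
      rw [hψ, hu, mul_div_assoc, e, mul_left_comm, ← exp_add]
      congr 2
      push_cast; ring
    have hs := mul_exp_mul_I_mem_slitPlane (inv_pos.2 hρ) hψ1 hψ2
    have hc : Filter.Tendsto (fun r : ℝ => cutArg (u / (q 0 - q m + r * u)))
        (nhdsWithin 0 (Set.Ioi 0)) (nhds ψ) := by
      have h2 : ContinuousAt (fun r : ℝ => u / (q 0 - q m + r * u)) 0 := by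
        refine ContinuousAt.div (by fun_prop) (by fun_prop) ?_
        simpa using he1
      have h3 : ContinuousAt cutArg (u / (q 0 - q m + (0 : ℝ) * u)) := by
        rw [ofReal_zero, zero_mul, add_zero, hlim]
        exact continuousAt_cutArg hs
      have h4 := (ContinuousAt.comp (f := fun r : ℝ => u / (q 0 - q m + r * u)) h3 h2).tendsto
      simp only [Function.comp_def] at h4
      rw [ofReal_zero, zero_mul, add_zero, hlim, cutArg_of_mem_slitPlane hs,
        arg_mul_exp_mul_I (inv_pos.2 hρ) hψ1 hψ2] at h4
      exact h4.mono_left nhdsWithin_le_nhds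
    refine hc.congr' ?_
    filter_upwards [self_mem_nhdsWithin] with r hr
    rw [Set.mem_Ioi] at hr
    have hrc : (r : ℂ) ≠ 0 := by exact_mod_cast hr.ne'
    rw [sight, ← cutArg_real_mul hr]
    congr 1
    rw [show q 0 - (q 0 + (r : ℂ) * exp ((θ : ℂ) * I) * (q 1 - q 0)) = -(r * u) by rw [hu]; ring,
      show q m - (q 0 + (r : ℂ) * exp ((θ : ℂ) * I) * (q 1 - q 0)) = -(q 0 - q m + r * u) by
        rw [hu]; ring, neg_div_neg_eq, ← mul_div_assoc]

/-- Near its base point, the complement of a simple closed polygonal line consists of two connected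
parts, one on each side. -/
theorem exists_local_sides (h : IsSimpleLoop m q) : ∃ ε > 0, ∃ S₁ S₂ : Set ℂ,
    IsPreconnected S₁ ∧ IsPreconnected S₂ ∧ S₁ ⊆ (loopTrace m q)ᶜ ∧ S₂ ⊆ (loopTrace m q)ᶜ ∧
    Metric.ball (q 0) ε \ loopTrace m q ⊆ S₁ ∪ S₂ ∧ q 0 ∈ closure S₁ ∧ q 0 ∈ closure S₂ ∧
    (∀ x ∈ S₁, windingAngle m q x = totalTurn m q / 2 + Real.pi) ∧
    ∀ x ∈ S₂, windingAngle m q x = totalTurn m q / 2 - Real.pi := by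
  obtain ⟨ε, hε, δ, hδ, hsub, hcov⟩ := h.exists_radius
  obtain ⟨ht1, ht2⟩ := h.turn_mem_Ioo
  set τ := turnAngle (q m) (q 0) (q 1) with hτ
  have hs1 := hsub 0 (Real.pi - τ) le_rfl (by linarith) (Or.inl le_rfl)
  have hs2 := hsub (Real.pi - τ) (2 * Real.pi) (by linarith) le_rfl (Or.inr le_rfl)
  have hp := isPreconnected_planeSector (q 0) (q 1 - q 0) δ
  refine ⟨ε, hε, _, _, hp _ _, hp _ _, hs1, hs2, hcov,
    mem_closure_planeSector _ _ hδ (by linarith), mem_closure_planeSector _ _ hδ (by linarith),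
    ?_, ?_⟩
  · rintro x hx
    obtain ⟨r₀, hr₀, θ, hθ, rfl⟩ := id hx
    -- In this sector ψ = θ + τ lies in (-π, π); in the other one the representative is θ + τ - 2π.
    -- Both θ and τ cancel from the limit, which leaves T/2 + π here and T/2 - π there. The winding
    -- angle is constant on the sector, so it equals its limit.
    have lim := h.tendsto_windingAngle (θ := θ) (ψ := θ + τ) hθ.1 (by linarith [hθ.2])
      (by linarith [hθ.1]) (by linarith [hθ.2]) rfl
    refine tendsto_nhds_unique (tendsto_const_nhds.congr' ?_) (lim.trans_eq ?_)
    · filter_upwards [Ioo_mem_nhdsGT hδ] with r hr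
      exact windingAngle_eq_of_isPreconnected h.closed (hp _ _) hs1 hx ⟨r, hr, θ, hθ, rfl⟩
    · rw [← hτ]; congr 1; ring
  · rintro x hx
    obtain ⟨r₀, hr₀, θ, hθ, rfl⟩ := id hx
    have lim := h.tendsto_windingAngle (θ := θ) (ψ := θ + τ - 2 * Real.pi)
      (by linarith [hθ.1]) hθ.2 (by linarith [hθ.1]) (by linarith [hθ.2]) (by
        push_cast
        rw [sub_mul, exp_sub, exp_two_pi_mul_I, div_one])
    refine tendsto_nhds_unique (tendsto_const_nhds.congr' ?_) (lim.trans_eq ?_)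
    · filter_upwards [Ioo_mem_nhdsGT hδ] with r hr
      exact windingAngle_eq_of_isPreconnected h.closed (hp _ _) hs2 hx ⟨r, hr, θ, hθ, rfl⟩
    · rw [← hτ]; congr 1; ring

end IsSimpleLoop

/-! ### Change of base point, and values on the loop -/

/-- A simple closed polygonal line with `m + 1` sides, as a periodic sequence of vertices. -/
structure IsPeriodicLoop (m : ℕ) (p : ℕ → ℂ) : Prop where
  two_le : 2 ≤ m
  periodic : ∀ i, p (i + (m + 1)) = p i
  turn : ∀ i, (p (i + 2) - p (i + 1)) / (p (i + 1) - p i) ∈ slitPlane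
  disj : ∀ i j, i + 1 < j → j < i + m →
    Disjoint (segment ℝ (p i) (p (i + 1))) (segment ℝ (p j) (p (j + 1)))

theorem sum_range_eq_add_sum_Ico (f : ℕ → ℝ) {n : ℕ} (hn : 0 < n) :
    ∑ i ∈ Finset.range n, f i = f 0 + ∑ i ∈ Finset.Ico 1 n, f i := by
  rw [Finset.range_eq_Ico, Finset.sum_eq_sum_Ico_succ_bot hn]

theorem sum_range_shift {m : ℕ} {f : ℕ → ℝ} (hf : ∀ i, f (i + m) = f i) (k : ℕ) :
    ∑ i ∈ Finset.range m, f (i + k) = ∑ i ∈ Finset.range m, f i := by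
  induction k with
  | zero => rfl
  | succ k ih =>
    rw [← ih]
    have h1 := Finset.sum_range_succ (fun i => f (i + k)) m
    have h2 := Finset.sum_range_succ' (fun i => f (i + k)) m
    have h3 : f (m + k) = f (0 + k) := by rw [zero_add, add_comm, hf]
    have h4 : ∑ i ∈ Finset.range m, f (i + (k + 1)) = ∑ i ∈ Finset.range m, f (i + 1 + k) :=
      Finset.sum_congr rfl fun i _ => by congr 1; ring
    linarith

theorem sight_add_sight_of_notMem {x a b y : ℂ} (h : x ∉ segment ℝ a b) (hy : y ∈ segment ℝ a b) :
    sight x a y + sight x y b = sight x a b := by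
  obtain ⟨k, hk⟩ := exists_re_pos_of_disjoint_segment (a := x) (b := x) (c := a) (d := b)
    (by rw [segment_same]; exact Set.disjoint_singleton_left.2 h)
  have hx := left_mem_segment ℝ x x
  have ha := hk x hx a (left_mem_segment ℝ a b)
  have hb := hk x hx b (right_mem_segment ℝ a b)
  have hy := hk x hx y hy
  unfold sight
  rw [cutArg_div_of_re_pos ha hy, cutArg_div_of_re_pos hy hb, cutArg_div_of_re_pos ha hb]
  ring

/-- Inside the segment the quotient is a negative real, of argument π, which `cutArg` replaces by 0.
At the endpoints the quotient is 0, for x = a by the convention on division by zero. -/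
theorem sight_eq_zero_of_mem {x a b : ℂ} (h : x ∈ segment ℝ a b) : sight x a b = 0 := by
  rw [segment_eq_image'] at h
  obtain ⟨s, hs, rfl⟩ := h
  simp only [real_smul, sight]
  by_cases hab : b - a = 0
  · rw [sub_eq_zero.1 hab]; simp [cutArg]
  rcases hs.1.eq_or_lt with h0 | h0
  · rw [← h0]; simp [cutArg]
  have h0c : (s : ℂ) ≠ 0 := by exact_mod_cast h0.ne'
  have e : (b - (a + s * (b - a))) / (a - (a + s * (b - a))) = ((-((1 - s) / s) : ℝ) : ℂ) := by
    rw [show a - (a + s * (b - a)) = -(s * (b - a)) by ring, div_eq_iff (by simp [h0c, hab])]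
    push_cast; field_simp; ring
  rw [e, cutArg]
  rcases hs.2.eq_or_lt with h1 | h1
  · rw [h1]; simp
  · rw [if_pos]
    exact arg_ofReal_of_neg (neg_neg_of_pos (div_pos (by linarith) h0))

theorem turnAngle_real_mul {a b c a' b' c' : ℂ} {s t : ℝ} (hs : 0 < s) (ht : 0 < t)
    (h1 : b' - a' = s * (b - a)) (h2 : c' - b' = t * (c - b)) :
    turnAngle a' b' c' = turnAngle a b c := by
  rw [turnAngle, turnAngle, h1, h2, mul_div_mul_comm, ← ofReal_div, arg_real_mul _ (div_pos ht hs)]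

theorem real_mul_mem_slitPlane {r : ℝ} (hr : 0 < r) {z : ℂ} (hz : z ∈ slitPlane) :
    (r : ℂ) * z ∈ slitPlane := by
  rw [mem_slitPlane_iff_arg] at *
  rw [arg_real_mul _ hr]
  exact ⟨hz.1, mul_ne_zero (by exact_mod_cast hr.ne') hz.2⟩

namespace IsPeriodicLoop

variable {m : ℕ} {p : ℕ → ℂ}

theorem periodic_mul (h : IsPeriodicLoop m p) (i k : ℕ) : p (i + k * (m + 1)) = p i := by
  induction k with
  | zero => simp
  | succ k ih => rw [add_mul, one_mul, ← add_assoc, h.periodic, ih]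

theorem closed (h : IsPeriodicLoop m p) : p (m + 1) = p 0 := by
  simpa using h.periodic 0

/-- Through the shift, what is known at the base point of a simple loop holds at every vertex. -/
theorem shift (h : IsPeriodicLoop m p) (k : ℕ) : IsPeriodicLoop m (fun i => p (i + k)) where
  two_le := h.two_le
  periodic i := by
    rw [show i + (m + 1) + k = i + k + (m + 1) by ring, h.periodic]
  turn i := by
    rw [show i + 2 + k = i + k + 2 by ring, show i + 1 + k = i + k + 1 by ring]
    exact h.turn _
  disj i j hij hj := by
    rw [show j + 1 + k = j + k + 1 by ring, show i + 1 + k = i + k + 1 by ring]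
    exact h.disj _ _ (by omega) (by omega)

theorem isSimpleLoop (h : IsPeriodicLoop m p) : IsSimpleLoop m p where
  two_le := h.two_le
  closed := h.closed
  turn i _ := h.turn i
  turn_last := by
    have := h.turn m
    rwa [h.closed, show m + 2 = 1 + (m + 1) by ring, h.periodic] at this
  disj i j hij hj hne := h.disj i j hij (by omega)

theorem mem_loopTrace_iff (h : IsPeriodicLoop m p) {z : ℂ} :
    z ∈ loopTrace m p ↔ ∃ i, z ∈ segment ℝ (p i) (p (i + 1)) := by
  constructor
  · rintro ⟨i, -, hi⟩
    exact ⟨i, hi⟩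
  · rintro ⟨i, hi⟩
    refine ⟨i % (m + 1), Nat.lt_succ_iff.1 (Nat.mod_lt _ (Nat.succ_pos m)), ?_⟩
    have e := Nat.mod_add_div i (m + 1)
    have e1 := h.periodic_mul (i % (m + 1)) (i / (m + 1))
    have e2 := h.periodic_mul (i % (m + 1) + 1) (i / (m + 1))
    rw [mul_comm, e] at e1
    rw [mul_comm, add_right_comm, e] at e2
    rwa [← e1, ← e2]

theorem loopTrace_shift (h : IsPeriodicLoop m p) (k : ℕ) :
    loopTrace m (fun i => p (i + k)) = loopTrace m p := by
  ext z
  rw [(h.shift k).mem_loopTrace_iff, h.mem_loopTrace_iff]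
  constructor
  · rintro ⟨i, hi⟩
    exact ⟨i + k, by rwa [add_right_comm]⟩
  · rintro ⟨i, hi⟩
    refine ⟨i + k * m, ?_⟩
    rw [show i + k * m + k = i + k * (m + 1) by ring,
      show i + k * m + 1 + k = i + 1 + k * (m + 1) by ring, h.periodic_mul, h.periodic_mul]
    exact hi

theorem windingAngle_shift (h : IsPeriodicLoop m p) (k : ℕ) :
    windingAngle m (fun i => p (i + k)) = windingAngle m p := by
  funext x
  have := sum_range_shift (m := m + 1) (f := fun i => sight x (p i) (p (i + 1)))
    (fun i => by rw [add_right_comm, h.periodic, h.periodic]) k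
  rw [windingAngle, windingAngle, ← this]
  exact Finset.sum_congr rfl fun i _ => by rw [add_right_comm]

theorem totalTurn_eq (h : IsPeriodicLoop m p) :
    totalTurn m p = ∑ i ∈ Finset.range (m + 1), turnAngle (p i) (p (i + 1)) (p (i + 2)) := by
  rw [totalTurn, Finset.sum_range_succ, h.closed, show m + 2 = 1 + (m + 1) by ring, h.periodic]

theorem totalTurn_shift (h : IsPeriodicLoop m p) (k : ℕ) :
    totalTurn m (fun i => p (i + k)) = totalTurn m p := by
  have := sum_range_shift (m := m + 1) (f := fun i => turnAngle (p i) (p (i + 1)) (p (i + 2)))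
    (fun i => by rw [add_right_comm, h.periodic, h.periodic, add_right_comm, h.periodic]) k
  rw [(h.shift k).totalTurn_eq, h.totalTurn_eq, ← this]
  exact Finset.sum_congr rfl fun i _ => by rw [add_right_comm, add_right_comm i 2 k]

/-- The polygonal line `p`, with a new vertex `y` on its first side as base point. -/
def subdivide (m : ℕ) (p : ℕ → ℂ) (y : ℂ) (i : ℕ) : ℂ := if i = 0 ∨ i = m + 2 then y else p i

theorem subdivide_apply_zero (y : ℂ) : subdivide m p y 0 = y := by simp [subdivide]

theorem subdivide_last (y : ℂ) : subdivide m p y (m + 2) = y := by simp [subdivide]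

theorem subdivide_of_ne (y : ℂ) {i : ℕ} (h0 : i ≠ 0) (h1 : i ≠ m + 2) :
    subdivide m p y i = p i := by simp [subdivide, h0, h1]

theorem apply_add_two (h : IsPeriodicLoop m p) : p (m + 2) = p 1 := by
  rw [show m + 2 = 1 + (m + 1) by ring, h.periodic]

/-- The new sequence is y, p 1, ..., p m, p (m + 1) = p 0, y. The two pieces of the cut side are
positive multiples of it, so the old exterior angles are unchanged and the new one is 0. -/
theorem isSimpleLoop_subdivide (h : IsPeriodicLoop m p) {y : ℂ} (hy : y ∈ segment ℝ (p 0) (p 1))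
    (h0 : y ≠ p 0) (h1 : y ≠ p 1) :
    IsSimpleLoop (m + 1) (subdivide m p y) ∧
      totalTurn (m + 1) (subdivide m p y) = totalTurn m p := by
  have hm := h.two_le
  have hy' := hy
  rw [segment_eq_image'] at hy'
  obtain ⟨s, hs, hys⟩ := hy'
  simp only [real_smul] at hys
  have hs0 : 0 < s := by
    refine hs.1.lt_of_ne ?_
    rintro rfl
    exact h0 (by rw [← hys]; simp)
  have hs1 : s < 1 := by
    refine hs.2.lt_of_ne ?_
    rintro rfl
    exact h1 (by rw [← hys]; simp)
  have d1 : p 1 - y = (1 - s : ℝ) * (p 1 - p 0) := by push_cast; rw [← hys]; ring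
  have d0 : y - p 0 = s * (p 1 - p 0) := by rw [← hys]; ring
  have hs1' : 0 < 1 - s := by linarith
  have h01 : p 1 - p 0 ≠ 0 := h.isSimpleLoop.sub_ne_zero
  have sub0 : segment ℝ (p 0) y ⊆ segment ℝ (p 0) (p 1) :=
    (convex_segment _ _).segment_subset (left_mem_segment ℝ _ _) hy
  have sub1 : segment ℝ y (p 1) ⊆ segment ℝ (p 0) (p 1) :=
    (convex_segment _ _).segment_subset hy (right_mem_segment ℝ _ _)
  have ratio : (p 1 - y) / (y - p 0) = (((1 - s) / s : ℝ) : ℂ) := by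
    have : (s : ℂ) ≠ 0 := by exact_mod_cast hs0.ne'
    rw [d1, d0]; push_cast; field_simp
  have hratio : 0 < (1 - s) / s := div_pos hs1' hs0
  have rslit : (p 1 - y) / (y - p 0) ∈ slitPlane := by rw [ratio, ofReal_mem_slitPlane]; exact hratio
  have n0 : p 0 ∉ segment ℝ y (p 1) := fun hx =>
    h0 (eq_of_mem_segment_of_mem_segment rslit (left_mem_segment ℝ _ _) hx).symm
  have n1 : p 1 ∉ segment ℝ (p 0) y := fun hx =>
    h1 (eq_of_mem_segment_of_mem_segment rslit hx (right_mem_segment ℝ _ _)).symm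
  have q0 := subdivide_apply_zero (m := m) (p := p) y
  have ql := subdivide_last (m := m) (p := p) y
  have qn : ∀ {i}, i ≠ 0 → i ≠ m + 2 → subdivide m p y i = p i := subdivide_of_ne y
  have q1 : subdivide m p y 1 = p 1 := qn (by omega) (by omega)
  have qm1 : subdivide m p y (m + 1) = p 0 := by rw [qn (by omega) (by omega), h.closed]
  refine ⟨⟨by omega, ?_, ?_, ?_, ?_⟩, ?_⟩
  · rw [q0]; exact ql
  · intro i hi
    rcases Nat.eq_zero_or_pos i with rfl | hi0
    · have ht := h.turn 0
      rw [q0, zero_add, zero_add, q1, qn (by omega) (by omega), d1, mul_comm, ← div_div,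
        div_eq_mul_inv, mul_comm, ← ofReal_inv]
      exact real_mul_mem_slitPlane (inv_pos.2 hs1') ht
    rcases (Nat.lt_succ_iff.1 hi).eq_or_lt with rfl | him
    · have ht := h.turn i
      rw [h.apply_add_two, h.closed] at ht
      rw [ql, qm1, qn (by omega) (by omega), d0, mul_div_assoc]
      exact real_mul_mem_slitPlane hs0 ht
    · rw [qn (by omega) (by omega), qn (by omega) (by omega), qn (by omega) (by omega)]
      exact h.turn i
  · rw [q1, q0, qm1]; exact rslit
  · intro i j hij hj hne
    rcases Nat.eq_zero_or_pos i with rfl | hi0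
    · rw [q0, zero_add, q1, qn (by omega) (by omega), qn (by omega) (by omega)]
      rcases Nat.lt_or_ge j m with hjm | hjm
      · exact (h.disj 0 j hij (by omega)).mono_left sub1
      · obtain rfl : j = m := by omega
        rw [Set.disjoint_left]
        intro z hz1 hz2
        have ht := h.turn j
        have hz : z = p (j + 1) := eq_of_mem_segment_of_mem_segment ht hz2
          (by rw [h.apply_add_two, h.closed]; exact sub1 hz1)
        rw [h.closed] at hz
        exact n0 (hz ▸ hz1)
    · rw [qn (i := i) (by omega) (by omega), qn (i := i + 1) (by omega) (by omega)]
      rcases hj.eq_or_lt with rfl | hjm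
      · rw [ql, qm1]
        rcases Nat.lt_or_ge 1 i with hi1 | hi1
        · refine (h.disj i (m + 1) hij (by omega)).mono_right ?_
          rw [h.apply_add_two, h.closed]; exact sub0
        · obtain rfl : i = 1 := by omega
          rw [Set.disjoint_left]
          intro z hz1 hz2
          have hz : z = p (0 + 1) :=
            eq_of_mem_segment_of_mem_segment (h.turn 0) (sub0 hz2) hz1
          exact n1 (hz ▸ hz2)
      · rw [qn (i := j) (by omega) (by omega), qn (i := j + 1) (by omega) (by omega)]
        exact h.disj i j hij (by omega)
  · rw [totalTurn, totalTurn, Finset.sum_range_succ,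
      sum_range_eq_add_sum_Ico _ (by omega), sum_range_eq_add_sum_Ico _ (by omega),
      ql, qm1, q0, qn (i := m) (by omega) (by omega), zero_add, q1,
      qn (i := 2) (by omega) (by omega)]
    have t1 : turnAngle y (p 1) (p 2) = turnAngle (p 0) (p 1) (p 2) :=
      turnAngle_real_mul hs1' one_pos d1 (by simp)
    have t2 : turnAngle (p m) (p 0) y = turnAngle (p m) (p 0) (p 1) :=
      turnAngle_real_mul one_pos hs0 (by simp) d0
    have t3 : turnAngle (p 0) y (p 1) = 0 := by
      rw [turnAngle, ratio, arg_ofReal_of_nonneg hratio.le]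
    have t4 : ∑ i ∈ Finset.Ico 1 m, turnAngle (subdivide m p y i) (subdivide m p y (i + 1))
        (subdivide m p y (i + 2)) =
        ∑ i ∈ Finset.Ico 1 m, turnAngle (p i) (p (i + 1)) (p (i + 2)) := by
      refine Finset.sum_congr rfl fun i hi => ?_
      rw [Finset.mem_Ico] at hi
      rw [qn (by omega) (by omega), qn (by omega) (by omega), qn (by omega) (by omega)]
    rw [zero_add, t1, t2, t3, t4]
    ring

theorem loopTrace_subdivide (h : IsPeriodicLoop m p) {y : ℂ} (hy : y ∈ segment ℝ (p 0) (p 1)) :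
    loopTrace (m + 1) (subdivide m p y) = loopTrace m p := by
  have hm := h.two_le
  have sub0 : segment ℝ (p 0) y ⊆ segment ℝ (p 0) (p 1) :=
    (convex_segment _ _).segment_subset (left_mem_segment ℝ _ _) hy
  have sub1 : segment ℝ y (p 1) ⊆ segment ℝ (p 0) (p 1) :=
    (convex_segment _ _).segment_subset hy (right_mem_segment ℝ _ _)
  have q0 := subdivide_apply_zero (m := m) (p := p) y
  have ql := subdivide_last (m := m) (p := p) y
  have qn : ∀ {i}, i ≠ 0 → i ≠ m + 2 → subdivide m p y i = p i := subdivide_of_ne y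
  have q1 : subdivide m p y 1 = p 1 := qn (by omega) (by omega)
  have qm1 : subdivide m p y (m + 1) = p 0 := by rw [qn (by omega) (by omega), h.closed]
  ext z
  constructor
  · rintro ⟨i, him, hi⟩
    rcases Nat.eq_zero_or_pos i with rfl | hi0
    · rw [q0, zero_add, q1] at hi
      exact ⟨0, by omega, sub1 hi⟩
    rcases him.eq_or_lt with rfl | him
    · rw [ql, qm1] at hi
      exact ⟨0, by omega, sub0 hi⟩
    · rw [qn (by omega) (by omega), qn (by omega) (by omega)] at hi
      exact ⟨i, by omega, hi⟩
  · rintro ⟨i, him, hi⟩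
    rcases Nat.eq_zero_or_pos i with rfl | hi0
    · have : z ∈ segment ℝ (p 0) y ∪ segment ℝ y (p 1) := by
        rw [segment_eq_image'] at hy hi
        obtain ⟨s, hs, rfl⟩ := hy
        obtain ⟨t, ht, rfl⟩ := hi
        simp only [real_smul]
        rcases le_total t s with hts | hts
        · left
          rw [segment_eq_image']
          rcases hs.1.eq_or_lt with h0 | h0
          · refine ⟨0, ⟨le_rfl, zero_le_one⟩, ?_⟩
            have : t = 0 := le_antisymm (h0 ▸ hts) ht.1
            simp [this]
          · refine ⟨t / s, ⟨div_nonneg ht.1 hs.1, (div_le_one h0).2 hts⟩, ?_⟩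
            have h0c : (s : ℂ) ≠ 0 := by exact_mod_cast h0.ne'
            simp only [real_smul, zero_add]
            push_cast
            field_simp
            ring
        · right
          rw [segment_symm, segment_eq_image']
          rcases hs.2.eq_or_lt with h0 | h0
          · refine ⟨0, ⟨le_rfl, zero_le_one⟩, ?_⟩
            have : t = 1 := le_antisymm ht.2 (h0 ▸ hts)
            simp [this]
          · have h1 : 0 < 1 - s := by linarith
            refine ⟨(1 - t) / (1 - s), ⟨div_nonneg (by linarith [ht.2]) h1.le,
              (div_le_one h1).2 (by linarith)⟩, ?_⟩
            have h0c : (1 - s : ℂ) ≠ 0 := by exact_mod_cast h1.ne'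
            simp only [real_smul, zero_add]
            push_cast
            field_simp
            ring
      rcases this with hz | hz
      · exact ⟨m + 1, le_rfl, by rw [qm1, ql]; exact hz⟩
      · exact ⟨0, by omega, by rw [q0, zero_add, q1]; exact hz⟩
    · exact ⟨i, by omega, by rw [qn (by omega) (by omega), qn (by omega) (by omega)]; exact hi⟩

/-- Only the sight of the first side is split. It is additive for x off that side, and for x = y the
three sights vanish; the second case serves to evaluate the winding angle on the loop itself. -/
theorem windingAngle_subdivide (h : IsPeriodicLoop m p) {x y : ℂ}
    (hy : y ∈ segment ℝ (p 0) (p 1)) (hx : x ∉ loopTrace m p ∨ x = y) :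
    windingAngle (m + 1) (subdivide m p y) x = windingAngle m p x := by
  have hm := h.two_le
  have q0 := subdivide_apply_zero (m := m) (p := p) y
  have ql := subdivide_last (m := m) (p := p) y
  have qn : ∀ {i}, i ≠ 0 → i ≠ m + 2 → subdivide m p y i = p i := subdivide_of_ne y
  have q1 : subdivide m p y 1 = p 1 := qn (by omega) (by omega)
  have qm1 : subdivide m p y (m + 1) = p 0 := by rw [qn (by omega) (by omega), h.closed]
  rw [windingAngle, windingAngle, Finset.sum_range_succ,
    sum_range_eq_add_sum_Ico _ (by omega), sum_range_eq_add_sum_Ico _ (by omega),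
    ql, qm1, q0, zero_add, q1]
  have t : ∑ i ∈ Finset.Ico 1 (m + 1), sight x (subdivide m p y i) (subdivide m p y (i + 1)) =
      ∑ i ∈ Finset.Ico 1 (m + 1), sight x (p i) (p (i + 1)) := by
    refine Finset.sum_congr rfl fun i hi => ?_
    rw [Finset.mem_Ico] at hi
    rw [qn (by omega) (by omega), qn (by omega) (by omega)]
  have e : sight x (p 0) y + sight x y (p 1) = sight x (p 0) (p 1) := by
    rcases hx with hx | rfl
    · exact sight_add_sight_of_notMem (fun h' => hx ⟨0, by omega, h'⟩) hy
    · rw [sight_eq_zero_of_mem hy, sight_eq_zero_of_mem (left_mem_segment ℝ _ _),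
        sight_eq_zero_of_mem (right_mem_segment ℝ _ _), add_zero]
  rw [t]
  linarith

end IsPeriodicLoop

/-- The two sides at `q 0` are seen under the angle 0, and the others are given by
`two_mul_sum_sight`. For total turning 2π this is the interior angle. -/
theorem IsSimpleLoop.windingAngle_base {m : ℕ} {q : ℕ → ℂ} (h : IsSimpleLoop m q) :
    windingAngle m q (q 0) = totalTurn m q / 2 - turnAngle (q m) (q 0) (q 1) := by
  have hm := h.two_le
  have hK := h.two_mul_sum_sight
  rw [windingAngle, Finset.sum_range_succ, Finset.range_eq_Ico,
    Finset.sum_eq_sum_Ico_succ_bot (by omega), h.closed,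
    sight_eq_zero_of_mem (left_mem_segment ℝ _ _), sight_eq_zero_of_mem (right_mem_segment ℝ _ _)]
  linarith

namespace IsPeriodicLoop

variable {m : ℕ} {p : ℕ → ℂ}

/-- The line can be rebased at any of its points. -/
theorem exists_rebase (h : IsPeriodicLoop m p) {y : ℂ} (hy : y ∈ loopTrace m p) :
    ∃ n q, IsSimpleLoop n q ∧ q 0 = y ∧ loopTrace n q = loopTrace m p ∧
      totalTurn n q = totalTurn m p ∧
      ∀ x ∉ loopTrace m p, windingAngle n q x = windingAngle m p x := by
  obtain ⟨i, hi⟩ := h.mem_loopTrace_iff.1 hy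
  have vertex : ∀ k, y = p k → ∃ n q, IsSimpleLoop n q ∧ q 0 = y ∧
      loopTrace n q = loopTrace m p ∧ totalTurn n q = totalTurn m p ∧
      ∀ x ∉ loopTrace m p, windingAngle n q x = windingAngle m p x := by
    intro k hk
    refine ⟨m, fun i => p (i + k), (h.shift k).isSimpleLoop, ?_, h.loopTrace_shift k,
      h.totalTurn_shift k, fun x _ => by rw [h.windingAngle_shift k]⟩
    simp [hk]
  by_cases h0 : y = p i
  · exact vertex i h0
  by_cases h1 : y = p (i + 1)
  · exact vertex (i + 1) h1
  have hs := h.shift i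
  have hy' : y ∈ segment ℝ (p (0 + i)) (p (1 + i)) := by rwa [zero_add, add_comm]
  obtain ⟨hq, ht⟩ := hs.isSimpleLoop_subdivide hy' (by rwa [zero_add]) (by rwa [add_comm])
  refine ⟨m + 1, _, hq, subdivide_apply_zero y, ?_, ?_, ?_⟩
  · rw [hs.loopTrace_subdivide hy', h.loopTrace_shift]
  · rw [ht, h.totalTurn_shift]
  · intro x hx
    rw [hs.windingAngle_subdivide hy' (Or.inl (by rwa [h.loopTrace_shift])), h.windingAngle_shift]

theorem windingAngle_vertex (h : IsPeriodicLoop m p) (i : ℕ) :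
    windingAngle m p (p (i + 1)) =
      totalTurn m p / 2 - turnAngle (p i) (p (i + 1)) (p (i + 2)) := by
  have := (h.shift (i + 1)).isSimpleLoop.windingAngle_base
  rw [h.windingAngle_shift, h.totalTurn_shift] at this
  rw [zero_add, show m + (i + 1) = i + (m + 1) by ring, h.periodic,
    show 1 + (i + 1) = i + 2 by ring] at this
  exact this

/-- Once the side through y is subdivided, y is a base point with exterior angle 0. -/
theorem windingAngle_of_mem (h : IsPeriodicLoop m p) {y : ℂ} (hy : y ∈ loopTrace m p)
    (hne : ∀ i, y ≠ p i) : windingAngle m p y = totalTurn m p / 2 := by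
  obtain ⟨i, hi⟩ := h.mem_loopTrace_iff.1 hy
  have hs := h.shift i
  have hy' : y ∈ segment ℝ (p (0 + i)) (p (1 + i)) := by rwa [zero_add, add_comm]
  obtain ⟨hq, ht⟩ := hs.isSimpleLoop_subdivide hy' (hne _) (hne _)
  have hb := hq.windingAngle_base
  rw [subdivide_apply_zero, ht, h.totalTurn_shift, hs.windingAngle_subdivide hy' (Or.inr rfl),
    h.windingAngle_shift, subdivide_of_ne y (by omega) (by omega),
    subdivide_of_ne y one_ne_zero (by omega)] at hb
  rw [hb, sub_eq_self, turnAngle]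
  have e : m + 1 + i = i + (m + 1) := by ring
  rw [e, h.periodic]
  rw [segment_eq_image'] at hi
  obtain ⟨s, hs, rfl⟩ := hi
  simp only [real_smul]
  have e2 : (p (1 + i) - (p i + s * (p (i + 1) - p i))) / (p i + s * (p (i + 1) - p i) - p i) =
      (((1 - s) / s : ℝ) : ℂ) * ((p (i + 1) - p i) / (p (i + 1) - p i)) := by
    rw [add_comm 1 i]
    push_cast
    rw [← mul_div_mul_comm]
    congr 1 <;> ring
  rw [e2]
  rcases eq_or_ne (p (i + 1) - p i) 0 with h0 | h0
  · rw [h0]; simp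
  · rw [div_self h0, mul_one, arg_ofReal_of_nonneg (div_nonneg (by linarith [hs.2]) hs.1)]

end IsPeriodicLoop

/-! ### Turning tangents and the enclosed region -/

theorem isCompact_loopTrace (m : ℕ) (p : ℕ → ℂ) : IsCompact (loopTrace m p) := by
  have : loopTrace m p = ⋃ i ∈ Finset.range (m + 1), segment ℝ (p i) (p (i + 1)) := by
    ext z
    simp [loopTrace]
  rw [this]
  exact (Finset.range (m + 1)).isCompact_biUnion fun i _ => isCompact_segment_complex _ _

theorem loopTrace_nonempty (m : ℕ) (p : ℕ → ℂ) : (loopTrace m p).Nonempty :=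
  ⟨p 0, 0, Nat.zero_le _, left_mem_segment ℝ _ _⟩

theorem exists_far (m : ℕ) {p : ℕ → ℂ} (hp : p (m + 1) = p 0) :
    ∃ R > 0, ∀ x, R < ‖x‖ → x ∉ loopTrace m p ∧ windingAngle m p x = 0 := by
  refine ⟨∑ i ∈ Finset.range (m + 2), ‖p i‖ + 1, by positivity, fun x hx => ?_⟩
  have hle : ∀ i ≤ m + 1, ‖p i‖ ≤ ∑ i ∈ Finset.range (m + 2), ‖p i‖ := fun i hi =>
    Finset.single_le_sum (f := fun i => ‖p i‖) (fun _ _ => norm_nonneg _)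
      (Finset.mem_range.2 (by omega))
  constructor
  · rintro ⟨i, hi, hz⟩
    have := (convex_closedBall (0 : ℂ) (∑ i ∈ Finset.range (m + 2), ‖p i‖)).segment_subset
      (mem_closedBall_zero_iff.2 (hle i (by omega)))
      (mem_closedBall_zero_iff.2 (hle (i + 1) (by omega))) hz
    rw [mem_closedBall_zero_iff] at this
    linarith
  · refine windingAngle_eq_zero hp (k := -(starRingEnd ℂ) x) fun i hi => ?_
    have h1 : (-(starRingEnd ℂ) x * (p i - x)).re = ‖x‖ ^ 2 - ((starRingEnd ℂ) x * p i).re := by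
      rw [← normSq_eq_norm_sq, normSq_apply]
      simp
      ring
    have h2 : ((starRingEnd ℂ) x * p i).re ≤ ‖x‖ * ‖p i‖ := by
      refine (re_le_norm _).trans ?_
      rw [norm_mul, RCLike.norm_conj]
    have h3 := hle i (by omega)
    have h4 := norm_nonneg (p i)
    rw [h1]
    nlinarith

namespace IsPeriodicLoop

variable {m : ℕ} {p : ℕ → ℂ}

theorem isPreconnected_loopTrace (h : IsPeriodicLoop m p) : IsPreconnected (loopTrace m p) := by
  have : loopTrace m p = ⋃ i, segment ℝ (p i) (p (i + 1)) := by
    ext z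
    rw [h.mem_loopTrace_iff, Set.mem_iUnion]
  rw [this]
  refine IsPreconnected.iUnion_of_chain (fun i => (convex_segment _ _).isPreconnected) fun i => ?_
  exact ⟨p (i + 1), right_mem_segment ℝ _ _, left_mem_segment ℝ _ _⟩

theorem exists_sides (h : IsPeriodicLoop m p) {y : ℂ} (hy : y ∈ loopTrace m p) :
    ∃ ε > 0, ∃ S₁ S₂ : Set ℂ,
    IsPreconnected S₁ ∧ IsPreconnected S₂ ∧ S₁ ⊆ (loopTrace m p)ᶜ ∧ S₂ ⊆ (loopTrace m p)ᶜ ∧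
    Metric.ball y ε \ loopTrace m p ⊆ S₁ ∪ S₂ ∧ y ∈ closure S₁ ∧ y ∈ closure S₂ ∧
    (∀ x ∈ S₁, windingAngle m p x = totalTurn m p / 2 + Real.pi) ∧
    ∀ x ∈ S₂, windingAngle m p x = totalTurn m p / 2 - Real.pi := by
  obtain ⟨n, q, hq, rfl, e1, e2, e3⟩ := h.exists_rebase hy
  obtain ⟨ε, hε, S₁, S₂, h1, h2, h3, h4, h5, h6, h7, h8, h9⟩ := hq.exists_local_sides
  rw [e1] at h3 h4 h5
  rw [e2] at h8 h9
  exact ⟨ε, hε, S₁, S₂, h1, h2, h3, h4, h5, h6, h7, fun x hx => by rw [← e3 x (h3 hx), h8 x hx],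
    fun x hx => by rw [← e3 x (h4 hx), h9 x hx]⟩

/-- Every point off the line lies in an open disc off the line whose closure meets the line. -/
theorem exists_ball (m : ℕ) (p : ℕ → ℂ) {x : ℂ} (hx : x ∉ loopTrace m p) :
    ∃ r > 0, Metric.ball x r ⊆ (loopTrace m p)ᶜ ∧
      ∃ y ∈ loopTrace m p, y ∈ closure (Metric.ball x r) := by
  obtain ⟨y, hy, hd⟩ := (isCompact_loopTrace m p).exists_infDist_eq_dist (loopTrace_nonempty m p) x
  have hr : 0 < dist x y := dist_pos.2 (by rintro rfl; exact hx hy)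
  refine ⟨dist x y, hr, fun z hz hzt => ?_, y, hy, ?_⟩
  · have := Metric.infDist_le_dist_of_mem (x := x) hzt
    rw [Metric.mem_ball, dist_comm] at hz
    linarith
  · rw [closure_ball x hr.ne', Metric.mem_closedBall, dist_comm]

/-- Every point off the line can be joined to one of the two sides of the line, near one of its
points. -/
theorem exists_connected_to_side (m : ℕ) (p : ℕ → ℂ) {x : ℂ} (hx : x ∉ loopTrace m p) :
    ∃ y ∈ loopTrace m p, ∀ ε > 0, ∃ z ∈ Metric.ball y ε, ∃ B, IsPreconnected B ∧ x ∈ B ∧ z ∈ B ∧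
      B ⊆ (loopTrace m p)ᶜ := by
  obtain ⟨r, hr, hsub, y, hy, hcl⟩ := exists_ball m p hx
  refine ⟨y, hy, fun ε hε => ?_⟩
  obtain ⟨z, hz, hd⟩ := Metric.mem_closure_iff.1 hcl ε hε
  exact ⟨z, by rwa [Metric.mem_ball, dist_comm], _, (convex_ball x r).isPreconnected,
    Metric.mem_ball_self hr, hz, hsub⟩

/-- The largest disc around x off the loop touches it at some y, so x is joined off the loop to
points arbitrarily near y, where the winding angle is known. -/
theorem windingAngle_eq_or (h : IsPeriodicLoop m p) {x : ℂ} (hx : x ∉ loopTrace m p) :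
    windingAngle m p x = totalTurn m p / 2 + Real.pi ∨
      windingAngle m p x = totalTurn m p / 2 - Real.pi := by
  obtain ⟨y, hy, hz⟩ := exists_connected_to_side m p hx
  obtain ⟨ε, hε, S₁, S₂, -, -, -, -, hcov, -, -, h8, h9⟩ := h.exists_sides hy
  obtain ⟨z, hzb, B, hB, hxB, hzB, hsub⟩ := hz ε hε
  rw [windingAngle_eq_of_isPreconnected h.closed hB hsub hxB hzB]
  rcases hcov ⟨hzb, hsub hzB⟩ with h' | h'
  · exact Or.inl (h8 z h')
  · exact Or.inr (h9 z h')

/-- The theorem of turning tangents for simple closed polygonal lines. -/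
theorem totalTurn_eq_or (h : IsPeriodicLoop m p) :
    totalTurn m p = 2 * Real.pi ∨ totalTurn m p = -(2 * Real.pi) := by
  -- Far away the winding angle is 0, and it must be T/2 + π or T/2 - π.
  obtain ⟨R, hR, hfar⟩ := exists_far m h.closed
  obtain ⟨h1, h2⟩ := hfar ((R + 1 : ℝ) : ℂ) (by
    rw [norm_real, Real.norm_of_nonneg (by linarith)]; linarith)
  rcases h.windingAngle_eq_or h1 with h3 | h3
  · right; linarith
  · left; linarith

/-- Two points off a positively oriented simple closed polygonal line around which the line does
not wind can be joined off the line. -/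
theorem connectedComponentIn_eq_of_windingAngle_eq_zero (h : IsPeriodicLoop m p)
    (hT : totalTurn m p = 2 * Real.pi)
    {x x' : ℂ} (hx : x ∉ loopTrace m p) (hx' : x' ∉ loopTrace m p) (h0 : windingAngle m p x = 0)
    (h0' : windingAngle m p x' = 0) :
    connectedComponentIn (loopTrace m p)ᶜ x = connectedComponentIn (loopTrace m p)ᶜ x' := by
  set U := (loopTrace m p)ᶜ with hU
  have joined : ∀ {B : Set ℂ}, IsPreconnected B → B ⊆ U → ∀ {z w}, z ∈ B → w ∈ B →
      connectedComponentIn U z = connectedComponentIn U w := fun hB hBU z w hz hw =>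
    _root_.connectedComponentIn_eq (hB.subset_connectedComponentIn hz hBU hw)
  have hpi := Real.pi_pos
  -- Near y the points of winding angle 0 all lie in S₂, because the angle is 2π on S₁. Hence they
  -- share one component, K.
  have loc : ∀ y ∈ loopTrace m p, ∃ ε > 0, ∃ K, (∀ δ > 0, ∃ z ∈ Metric.ball y δ, z ∈ U ∧
      windingAngle m p z = 0) ∧
      ∀ z ∈ Metric.ball y ε, z ∈ U → windingAngle m p z = 0 → connectedComponentIn U z = K := by
    intro y hy
    obtain ⟨ε, hε, S₁, S₂, -, hS2, -, hsub, hcov, -, hcl, h8, h9⟩ := h.exists_sides hy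
    obtain ⟨w, hw, -⟩ := Metric.mem_closure_iff.1 hcl 1 one_pos
    refine ⟨ε, hε, connectedComponentIn U w, fun δ hδ => ?_, fun z hz hzU hz0 => ?_⟩
    · obtain ⟨z, hz, hd⟩ := Metric.mem_closure_iff.1 hcl δ hδ
      refine ⟨z, by rwa [Metric.mem_ball, dist_comm], hsub hz, ?_⟩
      rw [h9 z hz, hT]; ring
    · rcases hcov ⟨hz, hzU⟩ with h' | h'
      · have := h8 z h'
        rw [hT, hz0] at this
        linarith
      · exact joined hS2 hsub h' hw
  choose! ε hε K hnear hK using loc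
  -- K is locally constant: a point of winding angle 0 close enough to y' is also within the radius
  -- of y. The loop is connected, so K is constant.
  have hconst : ∀ {y y'}, y ∈ loopTrace m p → y' ∈ loopTrace m p → K y = K y' := by
    refine h.isPreconnected_loopTrace.induction₂ (fun y y' => K y = K y') ?_
      (fun _ _ _ _ _ _ => Eq.trans) (fun _ _ _ _ => Eq.symm)
    intro y hy
    filter_upwards [self_mem_nhdsWithin, mem_nhdsWithin_of_mem_nhds
      (Metric.ball_mem_nhds y (hε y hy))] with y' hy' hb
    rw [Metric.mem_ball] at hb
    obtain ⟨z, hz, hzU, hz0⟩ := hnear y' hy' (min (ε y') (ε y - dist y' y))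
      (lt_min (hε y' hy') (by linarith))
    rw [Metric.mem_ball, lt_min_iff] at hz
    rw [← hK y' hy' z hz.1 hzU hz0, ← hK y hy z _ hzU hz0]
    rw [Metric.mem_ball]
    linarith [dist_triangle z y' y]
  have comp : ∀ {x}, x ∈ U → windingAngle m p x = 0 →
      ∃ y ∈ loopTrace m p, connectedComponentIn U x = K y := by
    intro x hx h0
    obtain ⟨y, hy, hz⟩ := exists_connected_to_side m p hx
    obtain ⟨z, hzb, B, hB, hxB, hzB, hsub⟩ := hz (ε y) (hε y hy)
    refine ⟨y, hy, ?_⟩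
    rw [joined hB hsub hxB hzB]
    refine hK y hy z hzb (hsub hzB) ?_
    rw [← windingAngle_eq_of_isPreconnected h.closed hB hsub hxB hzB, h0]
  obtain ⟨y, hy, e⟩ := comp hx h0
  obtain ⟨y', hy', e'⟩ := comp hx' h0'
  rw [e, e', hconst hy hy']

/-- The part of the plane enclosed by a positively oriented simple closed polygonal line. -/
theorem isBounded_connectedComponentIn_iff (h : IsPeriodicLoop m p)
    (hT : totalTurn m p = 2 * Real.pi) {x : ℂ} (hx : x ∉ loopTrace m p) :
    Bornology.IsBounded (connectedComponentIn (loopTrace m p)ᶜ x) ↔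
      windingAngle m p x = 2 * Real.pi := by
  obtain ⟨R, hR, hfar⟩ := exists_far m h.closed
  constructor
  · intro hb
    rcases h.windingAngle_eq_or hx with h1 | h1
    · rw [h1, hT]; ring
    · exfalso
      have h0 : windingAngle m p x = 0 := by rw [h1, hT]; ring
      obtain ⟨R', hR'⟩ := hb.subset_closedBall 0
      -- A point outside every relevant ball: its winding angle is 0, so it would lie in the
      -- component of x, which is supposed to be bounded by R'.
      set M := max R R' + 1 with hM
      have hMn : ‖((M : ℝ) : ℂ)‖ = M := by
        rw [norm_real, Real.norm_of_nonneg]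
        have := le_max_left R R'
        linarith
      obtain ⟨h2, h3⟩ := hfar (M : ℂ) (by rw [hMn]; linarith [le_max_left R R'])
      have h4 : (M : ℂ) ∈ connectedComponentIn (loopTrace m p)ᶜ x := by
        rw [h.connectedComponentIn_eq_of_windingAngle_eq_zero hT hx h2 h0 h3]
        exact mem_connectedComponentIn h2
      have := hR' h4
      rw [mem_closedBall_zero_iff, hMn] at this
      linarith [le_max_right R R']
  · intro h1
    refine (Metric.isBounded_closedBall (x := (0 : ℂ)) (r := R)).subset fun z hz => ?_
    rw [mem_closedBall_zero_iff]
    by_contra hlt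
    have h2 := (hfar z (not_le.1 hlt)).2
    rw [windingAngle_eq_of_isPreconnected h.closed isPreconnected_connectedComponentIn
      (connectedComponentIn_subset _ _) hz (mem_connectedComponentIn hx), h1] at h2
    linarith [Real.pi_pos]

end IsPeriodicLoop

/-! ### Invariant measures and the shoelace formula -/

open MeasureTheory

/-- The lattice point `z` as a complex number. -/
def latticeToComplex (z : ℤ × ℤ) : ℂ := ⟨z.1, z.2⟩

/-- The determinant of two lattice vectors. -/
def latticeDet (p q : ℤ × ℤ) : ℤ := p.1 * q.2 - q.1 * p.2

/-- A function of triangles that is an alternating cocycle and is invariant under translations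
and the point reflection is a multiple of the area. -/
theorem eq_latticeDet_mul_of_cocycle {F : ℤ × ℤ → ℤ × ℤ → ℤ × ℤ → ℝ}
    (hcoc : ∀ a b c d, F b c d + F a b d = F a c d + F a b c)
    (htr : ∀ z a b c, F (a + z) (b + z) (c + z) = F a b c)
    (hneg : ∀ a b c, F (-a) (-b) (-c) = F a b c)
    (hswap : ∀ a b c, F b a c = -F a b c) (hcyc : ∀ a b c, F b c a = F a b c) (p q : ℤ × ℤ) :
    F 0 p q = latticeDet p q * F 0 (1, 0) (1, 1) := by
  set g : ℤ × ℤ → ℤ × ℤ → ℝ := fun p q => F 0 p (p + q) with hg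
  have hF : ∀ a b c, F a (a + b) (a + b + c) = g b c := by
    intro a b c
    have := htr a 0 b (b + c)
    refine Eq.trans ?_ this
    congr 1 <;> abel
  have anti : ∀ p q, g q p = -g p q := by
    intro p q
    have h1 := hneg 0 p (p + q)
    have h2 := htr (p + q) (-0) (-p) (-(p + q))
    have e1 : -0 + (p + q) = p + q := by abel
    have e2 : -p + (p + q) = q := by abel
    have e3 : -(p + q) + (p + q) = 0 := by abel
    rw [e1, e2, e3] at h2
    have h3 := hswap q (p + q) 0
    have h4 := hcyc 0 q (p + q)
    simp only [hg]
    rw [add_comm q p]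
    linarith
  have coc : ∀ p q r, g q r + g p (q + r) = g (p + q) r + g p q := by
    intro p q r
    have := hcoc 0 p (p + q) (p + q + r)
    rw [hF] at this
    simp only [hg]
    rw [← add_assoc p q r]
    linarith
  -- An antisymmetric 2-cocycle is additive: this combines the cocycle identity for the three cyclic
  -- permutations of p, q, r.
  have addl : ∀ p q r, g (p + q) r = g p r + g q r := by
    intro p q r
    have h1 := coc p q r
    have h2 := coc q r p
    have h3 := coc r p q
    have h4 := anti p q
    have h5 := anti q r
    have h6 := anti r p
    have h7 := anti p (q + r)
    have h8 := anti q (r + p)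
    have h9 := anti r (p + q)
    linarith
  have addr : ∀ p q r, g p (q + r) = g p q + g p r := by
    intro p q r
    rw [anti (q + r) p, addl, anti p q, anti p r]; ring
  have self : ∀ p, g p p = 0 := by
    intro p
    have := anti p p
    linarith
  have smull : ∀ (n : ℤ) p q, g (n • p) q = n * g p q := by
    intro n p q
    have := map_zsmul (AddMonoidHom.mk' (fun p => g p q) fun _ _ => addl _ _ _) n p
    simpa using this
  have smulr : ∀ (n : ℤ) p q, g p (n • q) = n * g p q := by
    intro n p q
    rw [anti (n • q) p, smull, anti p q]; ring
  have e : ∀ p : ℤ × ℤ, p = p.1 • ((1, 0) : ℤ × ℤ) + p.2 • ((0, 1) : ℤ × ℤ) := by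
    intro p
    ext <;> simp
  have bil : ∀ p q, g p q = latticeDet p q * g (1, 0) (0, 1) := by
    intro p q
    conv_lhs => rw [e p, e q]
    rw [addl, addr, addr, smull, smull, smulr, smulr, smull, smulr, smull, smulr, self, self,
      anti (1, 0) (0, 1), latticeDet]
    push_cast
    ring
  have h1 : F 0 p q = g p (q - p) := by simp [hg]
  have h2 : F 0 (1, 0) (1, 1) = g (1, 0) (0, 1) := by simp [hg]
  have h3 : latticeDet p (q - p) = latticeDet p q := by
    simp only [latticeDet, Prod.fst_sub, Prod.snd_sub]; ring
  rw [h1, h2, bil, h3]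

/-- The winding angle of the triangle with vertices `a`, `b`, `c`. -/
noncomputable def triangleAngle (a b c x : ℂ) : ℝ := sight x a b + sight x b c + sight x c a

theorem measurable_cutArg : Measurable cutArg := by
  unfold cutArg
  exact Measurable.ite (measurable_arg (measurableSet_singleton _)) measurable_const measurable_arg

theorem measurable_sight (a b : ℂ) : Measurable fun x => sight x a b := by
  unfold sight
  exact measurable_cutArg.comp (by fun_prop)

theorem measurable_triangleAngle (a b c : ℂ) : Measurable (triangleAngle a b c) :=
  ((measurable_sight a b).add (measurable_sight b c)).add (measurable_sight c a)

theorem abs_triangleAngle_le (a b c x : ℂ) : |triangleAngle a b c x| ≤ 3 * Real.pi := by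
  have h1 : |sight x a b| ≤ Real.pi := abs_cutArg_le _
  have h2 : |sight x b c| ≤ Real.pi := abs_cutArg_le _
  have h3 : |sight x c a| ≤ Real.pi := abs_cutArg_le _
  have := abs_add_three (sight x a b) (sight x b c) (sight x c a)
  unfold triangleAngle
  linarith

theorem exists_triangleAngle_eq_zero (a b c : ℂ) :
    ∃ R, ∀ x, R < ‖x‖ → triangleAngle a b c x = 0 := by
  obtain ⟨R, -, hR⟩ := exists_far 2 (p := fun i => if i = 1 then b else if i = 2 then c else a)
    (by simp)
  refine ⟨R, fun x hx => ?_⟩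
  rw [← (hR x hx).2]
  simp [windingAngle, Finset.sum_range_succ, triangleAngle]

/-- A family of points `ι x` in the plane, with a measure `ν` on the index set, that is invariant
under lattice translations and under the point reflection in the origin. -/
structure IsLatticeInvariant {X : Type} [MeasurableSpace X] (ν : Measure X) (ι : X → ℂ) :
    Prop where
  measurable : Measurable ι
  finite : ∀ R, ν (ι ⁻¹' Metric.closedBall 0 R) ≠ ⊤
  translate : ∀ (z : ℤ × ℤ) (f : ℂ → ℝ), ∫ x, f (ι x + latticeToComplex z) ∂ν = ∫ x, f (ι x) ∂ν
  reflect : ∀ f : ℂ → ℝ, ∫ x, f (-ι x) ∂ν = ∫ x, f (ι x) ∂ν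

namespace IsLatticeInvariant

variable {X : Type} [MeasurableSpace X] {ν : Measure X} {ι : X → ℂ}

theorem integrable (h : IsLatticeInvariant ν ι) (a b c : ℂ) :
    Integrable (fun x => triangleAngle a b c (ι x)) ν := by
  obtain ⟨R, hR⟩ := exists_triangleAngle_eq_zero a b c
  rw [← integrableOn_iff_integrable_of_support_subset (s := ι ⁻¹' Metric.closedBall 0 R)]
  · exact Measure.integrableOn_of_bounded (h.finite R)
      ((measurable_triangleAngle a b c).comp h.measurable).aestronglyMeasurable
      (Filter.Eventually.of_forall fun x => abs_triangleAngle_le a b c (ι x))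
  · intro x hx
    by_contra hx'
    rw [Set.mem_preimage, mem_closedBall_zero_iff, not_le] at hx'
    exact hx (hR _ hx')

/-- The cocycle identity holds pointwise, since the two triangulations of a quadrangle differ only
by diagonals whose sights cancel. The remaining hypotheses are the invariances of the measure and
the antisymmetry of `sight`. -/
theorem integral_triangleAngle (h : IsLatticeInvariant ν ι) (p q : ℤ × ℤ) :
    ∫ x, triangleAngle 0 (latticeToComplex p) (latticeToComplex q) (ι x) ∂ν =
      latticeDet p q * ∫ x, triangleAngle 0 1 ⟨1, 1⟩ (ι x) ∂ν := by
  have h0 : latticeToComplex 0 = 0 := Complex.ext (by simp [latticeToComplex])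
    (by simp [latticeToComplex])
  have h1 : latticeToComplex (1, 0) = 1 := Complex.ext (by simp [latticeToComplex])
    (by simp [latticeToComplex])
  have h2 : latticeToComplex (1, 1) = ⟨1, 1⟩ := Complex.ext (by simp [latticeToComplex])
    (by simp [latticeToComplex])
  have hadd : ∀ a b, latticeToComplex (a + b) = latticeToComplex a + latticeToComplex b :=
    fun a b => Complex.ext (by simp [latticeToComplex]) (by simp [latticeToComplex])
  have hneg : ∀ a, latticeToComplex (-a) = -latticeToComplex a :=
    fun a => Complex.ext (by simp [latticeToComplex]) (by simp [latticeToComplex])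
  have := eq_latticeDet_mul_of_cocycle (F := fun a b c =>
    ∫ x, triangleAngle (latticeToComplex a) (latticeToComplex b) (latticeToComplex c) (ι x) ∂ν)
    ?_ ?_ ?_ ?_ ?_ p q
  · simpa only [h0, h1, h2] using this
  · intro a b c d
    rw [← integral_add (h.integrable _ _ _) (h.integrable _ _ _),
      ← integral_add (h.integrable _ _ _) (h.integrable _ _ _)]
    congr 1
    funext x
    simp only [triangleAngle]
    rw [sight_swap _ (latticeToComplex b) (latticeToComplex d),
      sight_swap _ (latticeToComplex a) (latticeToComplex c)]
    ring
  · intro z a b c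
    simp only [hadd]
    rw [← h.translate z]
    congr 1
    funext x
    simp only [triangleAngle, sight, add_sub_add_right_eq_sub]
  · intro a b c
    simp only [hneg]
    rw [← h.reflect]
    congr 1
    funext x
    have : ∀ u v w : ℂ, (-u - -v) / (-w - -v) = (u - v) / (w - v) := by
      intro u v w
      rw [show -u - -v = -(u - v) by ring, show -w - -v = -(w - v) by ring, neg_div_neg_eq]
    simp only [triangleAngle, sight, this]
  · intro a b c
    rw [← integral_neg]
    congr 1
    funext x
    simp only [triangleAngle]
    rw [sight_swap _ (latticeToComplex a) (latticeToComplex b),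
      sight_swap _ (latticeToComplex c) (latticeToComplex a),
      sight_swap _ (latticeToComplex b) (latticeToComplex c)]
    ring
  · intro a b c
    congr 1
    funext x
    simp only [triangleAngle]
    ring

end IsLatticeInvariant

/-! ### The unit square, which fixes the normalization -/

/-- The winding angle of the unit square. -/
noncomputable def squareAngle (x : ℂ) : ℝ :=
  sight x 0 1 + sight x 1 ⟨1, 1⟩ + sight x ⟨1, 1⟩ I + sight x I 0

theorem squareAngle_eq (x : ℂ) :
    squareAngle x = triangleAngle 0 1 ⟨1, 1⟩ x + triangleAngle 0 ⟨1, 1⟩ I x := by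
  rw [triangleAngle, triangleAngle, squareAngle, sight_swap x 0 ⟨1, 1⟩]
  ring

theorem sight_mem_Ioo {x a b : ℂ}
    (h : 0 < (b.im - x.im) * (a.re - x.re) - (b.re - x.re) * (a.im - x.im)) :
    0 < sight x a b ∧ sight x a b < Real.pi := by
  have hn : 0 < normSq (a - x) := by
    rw [normSq_pos]
    intro h'
    have h1 := congrArg Complex.re h'
    have h2 := congrArg Complex.im h'
    simp only [sub_re, sub_im, zero_re, zero_im] at h1 h2
    rw [h1, h2] at h
    simp at h
  have him : 0 < ((b - x) / (a - x)).im := by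
    rw [div_im, ← sub_div]
    exact div_pos (by simpa using h) hn
  have hlt := arg_lt_pi_iff.2 (Or.inr him.ne')
  rw [sight, cutArg, if_neg hlt.ne]
  exact ⟨(arg_nonneg_iff.2 him.le).lt_of_ne fun h0 => him.ne' (arg_eq_zero_iff.1 h0.symm).2, hlt⟩

/-- All four sights lie in (0, π), so their sum is a multiple of 2π strictly between 0 and 4π. -/
theorem squareAngle_of_mem {x : ℂ} (h1 : x.re ∈ Set.Ioo 0 1) (h2 : x.im ∈ Set.Ioo 0 1) :
    squareAngle x = 2 * Real.pi := by
  obtain ⟨h1, h1'⟩ := h1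
  obtain ⟨h2, h2'⟩ := h2
  have s1 : 0 < sight x 0 1 ∧ sight x 0 1 < Real.pi := sight_mem_Ioo (by simp; nlinarith)
  have s2 : 0 < sight x 1 ⟨1, 1⟩ ∧ sight x 1 ⟨1, 1⟩ < Real.pi := sight_mem_Ioo (by simp; nlinarith)
  have s3 : 0 < sight x ⟨1, 1⟩ I ∧ sight x ⟨1, 1⟩ I < Real.pi := sight_mem_Ioo (by simp; nlinarith)
  have s4 : 0 < sight x I 0 ∧ sight x I 0 < Real.pi := sight_mem_Ioo (by simp; nlinarith)
  have hcoe : ∀ {a b : ℂ}, 0 < sight x a b ∧ sight x a b < Real.pi →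
      (sight x a b : Real.Angle) = (b - x).arg - (a - x).arg := fun h =>
    coe_sight fun h' => h.1.ne' (sight_eq_zero_of_mem h')
  have h : (squareAngle x : Real.Angle) = 0 := by
    rw [squareAngle, Real.Angle.coe_add, Real.Angle.coe_add, Real.Angle.coe_add, hcoe s1, hcoe s2, hcoe s3, hcoe s4]
    abel
  obtain ⟨n, hn⟩ := Real.Angle.coe_eq_zero_iff.1 h
  have hpi := Real.pi_pos
  rw [zsmul_eq_mul] at hn
  have e : squareAngle x = sight x 0 1 + sight x 1 ⟨1, 1⟩ + sight x ⟨1, 1⟩ I + sight x I 0 := rfl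
  have l : (0 : ℝ) < n := by
    by_contra hc
    nlinarith
  have u : (n : ℝ) < 2 := by
    by_contra hc
    nlinarith
  have hl : 0 < n := by exact_mod_cast l
  have hu : n < 2 := by exact_mod_cast u
  obtain rfl : n = 1 := by omega
  rw [← hn]; push_cast; ring

theorem squareAngle_of_notMem {x : ℂ} (h : ¬ (x.re ∈ Set.Icc 0 1 ∧ x.im ∈ Set.Icc 0 1)) :
    squareAngle x = 0 := by
  have key : ∀ k : ℂ, 0 < (k * (0 - x)).re → 0 < (k * (1 - x)).re → 0 < (k * (⟨1, 1⟩ - x)).re →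
      0 < (k * (I - x)).re → squareAngle x = 0 := by
    intro k h0 h1 h2 h3
    rw [squareAngle, sight, sight, sight, sight, cutArg_div_of_re_pos h0 h1,
      cutArg_div_of_re_pos h1 h2, cutArg_div_of_re_pos h2 h3, cutArg_div_of_re_pos h3 h0]
    ring
  have h' : x.re < 0 ∨ 1 < x.re ∨ x.im < 0 ∨ 1 < x.im := by
    by_contra hc
    push Not at hc
    exact h ⟨⟨hc.1, hc.2.1⟩, hc.2.2.1, hc.2.2.2⟩
  rcases h' with h' | h' | h' | h'
  · apply key 1 <;> simp <;> linarith
  · apply key (-1) <;> simp <;> linarith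
  · apply key (-I) <;> simp <;> linarith
  · apply key I <;> simp <;> linarith

theorem cutArg_mk_self {r : ℝ} (hr : 0 < r) : cutArg ⟨r, r⟩ = Real.pi / 4 := by
  have hpi := Real.pi_pos
  have h2 : (0 : ℝ) < √2 := by positivity
  have h3 : √2 * √2 = 2 := Real.mul_self_sqrt (by norm_num)
  have e : (⟨r, r⟩ : ℂ) = ((r * √2 : ℝ) : ℂ) * exp ((Real.pi / 4 : ℝ) * I) := by
    apply Complex.ext
    · rw [re_ofReal_mul, exp_ofReal_mul_I_re, Real.cos_pi_div_four]
      linear_combination -r / 2 * h3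
    · rw [im_ofReal_mul, exp_ofReal_mul_I_im, Real.sin_pi_div_four]
      linear_combination -r / 2 * h3
  have hr2 : 0 < r * √2 := by positivity
  rw [e, cutArg_of_mem_slitPlane (mul_exp_mul_I_mem_slitPlane hr2 (by linarith) (by linarith)),
    arg_mul_exp_mul_I hr2 (by linarith) (by linarith)]

theorem sight_add_sight_corner {x a b c : ℂ} (hab : b - x = ⟨1, 1⟩ * (a - x))
    (hac : c - x = I * (a - x)) (ha : a - x ≠ 0) : sight x a b + sight x b c = Real.pi / 2 := by
  have h11 : (⟨1, 1⟩ : ℂ) ≠ 0 := by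
    intro h; simpa using congrArg Complex.re h
  have e : I / (⟨1, 1⟩ : ℂ) = ⟨1 / 2, 1 / 2⟩ := by
    rw [div_eq_iff h11]
    apply Complex.ext <;> simp
    norm_num
  rw [sight, sight, hab, hac, mul_div_assoc, div_self ha, mul_one, mul_div_mul_right _ _ ha, e,
    cutArg_mk_self one_pos, cutArg_mk_self (by norm_num)]
  ring

/-- From a corner only the two opposite sides contribute; the diagonal splits the right angle under
which they are seen into two angles π/4. -/
theorem squareAngle_corners : squareAngle 0 = Real.pi / 2 ∧ squareAngle 1 = Real.pi / 2 ∧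
    squareAngle ⟨1, 1⟩ = Real.pi / 2 ∧ squareAngle I = Real.pi / 2 := by
  have hl : ∀ a b : ℂ, sight a a b = 0 := fun a b => sight_eq_zero_of_mem (left_mem_segment ℝ _ _)
  have hr : ∀ a b : ℂ, sight b a b = 0 := fun a b => sight_eq_zero_of_mem (right_mem_segment ℝ _ _)
  refine ⟨?_, ?_, ?_, ?_⟩
  · have := sight_add_sight_corner (x := 0) (a := 1) (b := ⟨1, 1⟩) (c := I) (by simp) (by simp)
      (by simp)
    rw [squareAngle, hl, hr]; linarith
  · have := sight_add_sight_corner (x := 1) (a := ⟨1, 1⟩) (b := I) (c := 0)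
      (by apply Complex.ext <;> simp) (by apply Complex.ext <;> simp)
      (by intro h; simpa using congrArg Complex.im h)
    rw [squareAngle, hl, hr]; linarith
  · have := sight_add_sight_corner (x := ⟨1, 1⟩) (a := I) (b := 0) (c := 1)
      (by apply Complex.ext <;> simp) (by apply Complex.ext <;> simp)
      (by intro h; simpa using congrArg Complex.re h)
    rw [squareAngle, hl, hr]; linarith
  · have := sight_add_sight_corner (x := I) (a := 0) (b := 1) (c := ⟨1, 1⟩)
      (by apply Complex.ext <;> simp) (by apply Complex.ext <;> simp) (by simp)
    rw [squareAngle, hl, hr]; linarith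

namespace IsLatticeInvariant

variable {X : Type} [MeasurableSpace X] {ν : Measure X} {ι : X → ℂ}

/-- The integral of the winding angle of a closed lattice polygonal line is given by the shoelace
formula. -/
theorem integral_windingAngle (h : IsLatticeInvariant ν ι)
    (hsq : ∫ x, squareAngle (ι x) ∂ν = 2 * Real.pi) {m : ℕ} {v : ℕ → ℤ × ℤ}
    (hv : v (m + 1) = v 0) :
    Integrable (fun x => windingAngle m (fun i => latticeToComplex (v i)) (ι x)) ν ∧
    ∫ x, windingAngle m (fun i => latticeToComplex (v i)) (ι x) ∂ν =
      Real.pi * ∑ i ∈ Finset.range (m + 1), (latticeDet (v i) (v (i + 1)) : ℝ) := by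
  -- The diagonal cuts the square into two triangles of determinant 1, each with half of the
  -- integral 2π.
  have hunit : ∫ x, triangleAngle 0 1 ⟨1, 1⟩ (ι x) ∂ν = Real.pi := by
    have h1 := h.integral_triangleAngle (1, 1) (0, 1)
    have e1 : latticeToComplex (1, 1) = ⟨1, 1⟩ := Complex.ext (by simp [latticeToComplex])
      (by simp [latticeToComplex])
    have e2 : latticeToComplex (0, 1) = I := Complex.ext (by simp [latticeToComplex])
      (by simp [latticeToComplex])
    rw [e1, e2] at h1
    simp only [squareAngle_eq] at hsq
    rw [integral_add (h.integrable _ _ _) (h.integrable _ _ _), h1] at hsq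
    simp [latticeDet] at hsq
    linarith
  -- The polygon is a signed fan of triangles from the origin: the added sights of the spokes
  -- telescope to 0.
  have hsum : (fun x => windingAngle m (fun i => latticeToComplex (v i)) (ι x)) = fun x =>
      ∑ i ∈ Finset.range (m + 1),
        triangleAngle 0 (latticeToComplex (v i)) (latticeToComplex (v (i + 1))) (ι x) := by
    funext x
    have ht := Finset.sum_range_sub (fun i => sight (ι x) 0 (latticeToComplex (v i))) (m + 1)
    rw [hv, sub_self] at ht
    rw [windingAngle, ← sub_zero (∑ i ∈ Finset.range (m + 1), sight _ _ _), ← ht,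
      ← Finset.sum_sub_distrib]
    refine Finset.sum_congr rfl fun i _ => ?_
    rw [triangleAngle, sight_swap _ 0 (latticeToComplex (v (i + 1)))]
    ring
  rw [hsum]
  refine ⟨integrable_finsetSum _ fun i _ => h.integrable _ _ _, ?_⟩
  rw [integral_finsetSum _ fun i _ => h.integrable _ _ _, Finset.mul_sum]
  refine Finset.sum_congr rfl fun i _ => ?_
  rw [h.integral_triangleAngle, hunit, mul_comm]

end IsLatticeInvariant

/-! ### The two measures -/

/-- A point of the coordinate plane as a complex number. -/
def planeToComplex (x : ℝ × ℝ) : ℂ := ⟨x.1, x.2⟩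

theorem isLatticeInvariant_volume :
    IsLatticeInvariant (volume : Measure (ℝ × ℝ)) planeToComplex where
  measurable := Complex.measurableEquivRealProd.symm.measurable
  finite R := by
    have hsub : planeToComplex ⁻¹' Metric.closedBall 0 R ⊆ Set.Icc (-R) R ×ˢ Set.Icc (-R) R := by
      intro z hz
      rw [Set.mem_preimage, mem_closedBall_zero_iff] at hz
      exact ⟨abs_le.1 ((abs_re_le_norm (planeToComplex z)).trans hz),
        abs_le.1 ((abs_im_le_norm (planeToComplex z)).trans hz)⟩
    exact ((measure_mono hsub).trans_lt (isCompact_Icc.prod isCompact_Icc).measure_lt_top).ne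
  translate z f := by
    rw [← integral_add_right_eq_self (fun x => f (planeToComplex x)) ((z.1 : ℝ), (z.2 : ℝ))]
    rfl
  reflect f := by
    rw [← integral_neg_eq_self (fun x => f (planeToComplex x))]
    rfl

theorem isLatticeInvariant_count :
    IsLatticeInvariant (Measure.count : Measure (ℤ × ℤ)) latticeToComplex where
  measurable := measurable_of_countable _
  finite R := by
    refine (Measure.count_apply_lt_top.2 ?_).ne
    refine ((Set.finite_Icc (-⌈R⌉) ⌈R⌉).prod (Set.finite_Icc (-⌈R⌉) ⌈R⌉)).subset fun z hz => ?_
    rw [Set.mem_preimage, mem_closedBall_zero_iff] at hz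
    have h1 := abs_le.1 ((abs_re_le_norm (latticeToComplex z)).trans (hz.trans (Int.le_ceil R)))
    have h2 := abs_le.1 ((abs_im_le_norm (latticeToComplex z)).trans (hz.trans (Int.le_ceil R)))
    simp only [latticeToComplex] at h1 h2
    exact ⟨⟨by exact_mod_cast h1.1, by exact_mod_cast h1.2⟩,
      by exact_mod_cast h2.1, by exact_mod_cast h2.2⟩
  translate z f := by
    rw [← integral_add_right_eq_self (fun x => f (latticeToComplex x)) z]
    congr 1
    funext x
    congr 1
    apply Complex.ext <;> simp [latticeToComplex]
  reflect f := by
    rw [← integral_neg_eq_self (fun x => f (latticeToComplex x))]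
    congr 1
    funext x
    congr 1
    apply Complex.ext <;> simp [latticeToComplex]

theorem integral_squareAngle_volume :
    ∫ x, squareAngle (planeToComplex x) = 2 * Real.pi := by
  have h1 : ∫ x in Set.Icc (0 : ℝ) 1 ×ˢ Set.Icc (0 : ℝ) 1, squareAngle (planeToComplex x) =
      ∫ x, squareAngle (planeToComplex x) :=
    setIntegral_eq_integral_of_forall_compl_eq_zero fun x hx => squareAngle_of_notMem hx
  have h2 : (Set.Ioo (0 : ℝ) 1 ×ˢ Set.Ioo (0 : ℝ) 1 : Set (ℝ × ℝ)) =ᵐ[volume]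
      Set.Icc (0 : ℝ) 1 ×ˢ Set.Icc (0 : ℝ) 1 :=
    Measure.set_prod_ae_eq Ioo_ae_eq_Icc Ioo_ae_eq_Icc
  rw [← h1, ← setIntegral_congr_set h2,
    setIntegral_congr_fun (g := fun _ => 2 * Real.pi) (measurableSet_Ioo.prod measurableSet_Ioo)
      fun x hx => squareAngle_of_mem hx.1 hx.2, setIntegral_const, measureReal_def,
    Measure.volume_eq_prod, Measure.prod_prod, Real.volume_Ioo]
  simp

theorem integral_count_eq_sum {X : Type} [MeasurableSpace X] [MeasurableSingletonClass X]
    [Countable X] {f : X → ℝ} (s : Finset X) (hs : ∀ x ∉ s, f x = 0) :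
    ∫ x, f x ∂Measure.count = ∑ x ∈ s, f x := by
  rw [← setIntegral_eq_integral_of_forall_compl_eq_zero (s := (s : Set X))
    fun x hx => hs x (by simpa using hx), setIntegral_finset]
  · exact Finset.sum_congr rfl fun x _ => by simp [measureReal_def]
  · refine Measure.integrableOn_of_bounded (M := ∑ x ∈ s, |f x|)
      (Measure.count_apply_lt_top.2 s.finite_toSet).ne
      (measurable_of_countable f).aestronglyMeasurable (Filter.Eventually.of_forall fun x => ?_)
    by_cases hx : x ∈ s
    · exact Finset.single_le_sum (f := fun x => |f x|) (fun _ _ => abs_nonneg _) hx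
    · rw [hs x hx, norm_zero]
      exact Finset.sum_nonneg fun _ _ => abs_nonneg _

/-- Four corners with π/2 each give the same total as area 1 with angle 2π. This coincidence is the
source of Pick's formula. -/
theorem integral_squareAngle_count :
    ∫ x, squareAngle (latticeToComplex x) ∂Measure.count = 2 * Real.pi := by
  rw [integral_count_eq_sum ({(0, 0), (1, 0), (1, 1), (0, 1)} : Finset (ℤ × ℤ))]
  · obtain ⟨h1, h2, h3, h4⟩ := squareAngle_corners
    have e1 : latticeToComplex (0, 0) = 0 := Complex.ext (by simp [latticeToComplex])
      (by simp [latticeToComplex])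
    have e2 : latticeToComplex (1, 0) = 1 := Complex.ext (by simp [latticeToComplex])
      (by simp [latticeToComplex])
    have e3 : latticeToComplex (1, 1) = ⟨1, 1⟩ := Complex.ext (by simp [latticeToComplex])
      (by simp [latticeToComplex])
    have e4 : latticeToComplex (0, 1) = I := Complex.ext (by simp [latticeToComplex])
      (by simp [latticeToComplex])
    rw [Finset.sum_insert (by simp), Finset.sum_insert (by simp), Finset.sum_insert (by simp),
      Finset.sum_singleton, e1, e2, e3, e4, h1, h2, h3, h4]
    ring
  · rintro ⟨a, b⟩ hx
    refine squareAngle_of_notMem fun h' => hx ?_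
    simp only [latticeToComplex, Set.mem_Icc] at h'
    norm_cast at h'
    simp only [Finset.mem_insert, Finset.mem_singleton, Prod.mk.injEq]
    omega

/-! ### Lattice polygons: area, rotation number and Pick's inequality -/

theorem planeToComplex_latticePoint (z : ℤ × ℤ) :
    planeToComplex (latticePoint z) = latticeToComplex z := rfl

theorem planeToComplex_injective : Function.Injective planeToComplex := fun _ _ h =>
  Prod.ext (congrArg Complex.re h) (congrArg Complex.im h)

theorem latticeToComplex_injective : Function.Injective latticeToComplex := fun _ _ h => by
  have h1 := congrArg Complex.re h
  have h2 := congrArg Complex.im h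
  simp only [latticeToComplex, Int.cast_inj] at h1 h2
  exact Prod.ext h1 h2

theorem planeToComplex_lineMap (x y : ℝ × ℝ) (s : ℝ) :
    planeToComplex (AffineMap.lineMap x y s) =
      AffineMap.lineMap (planeToComplex x) (planeToComplex y) s := by
  apply Complex.ext <;> simp [planeToComplex, AffineMap.lineMap_apply]

theorem planeToComplex_mem_segment_iff {x a b : ℝ × ℝ} :
    planeToComplex x ∈ segment ℝ (planeToComplex a) (planeToComplex b) ↔ x ∈ segment ℝ a b := by
  rw [segment_eq_image_lineMap, segment_eq_image_lineMap]
  constructor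
  · rintro ⟨s, hs, h⟩
    rw [← planeToComplex_lineMap] at h
    exact ⟨s, hs, planeToComplex_injective h⟩
  · rintro ⟨s, hs, rfl⟩
    exact ⟨s, hs, (planeToComplex_lineMap _ _ _).symm⟩

theorem volume_segment (a b : ℝ × ℝ) : volume (segment ℝ a b) = 0 := by
  refine measure_mono_null (t := (line[ℝ, a, b] : Set (ℝ × ℝ))) ?_
    (Measure.addHaar_affineSubspace _ _ ?_)
  · rw [← convexHull_pair]
    exact convexHull_subset_affineSpan _
  · intro h
    have h1 := collinear_iff_finrank_le_one.1 (collinear_pair ℝ a b)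
    rw [← direction_affineSpan, h, AffineSubspace.direction_top, finrank_top] at h1
    simp at h1

namespace LatticePolygon

variable (P : LatticePolygon)

/-- The vertices of a lattice polygon, as a periodic sequence. -/
def latticeVertex (k : ℕ) : ℤ × ℤ := P.vertex (Fin.ofNat (P.n + 3) k)

/-- The vertices of a lattice polygon, as a periodic sequence of complex numbers. -/
def complexVertex (k : ℕ) : ℂ := latticeToComplex (P.latticeVertex k)

theorem ofNat_succ (k : ℕ) : Fin.ofNat (P.n + 3) (k + 1) = Fin.ofNat (P.n + 3) k + 1 := by
  apply Fin.ext
  simp [Fin.val_add]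

theorem ofNat_val (i : Fin (P.n + 3)) : Fin.ofNat (P.n + 3) i = i :=
  Fin.ext (Nat.mod_eq_of_lt i.2)

theorem latticeVertex_val (i : Fin (P.n + 3)) : P.latticeVertex i = P.vertex i := by
  rw [latticeVertex, ofNat_val]

theorem latticeVertex_val_succ (i : Fin (P.n + 3)) :
    P.latticeVertex (i + 1) = P.vertex (i + 1) := by
  rw [latticeVertex, ofNat_succ, ofNat_val]

theorem ofNat_eq_iff {i j : ℕ} :
    Fin.ofNat (P.n + 3) i = Fin.ofNat (P.n + 3) j ↔ i % (P.n + 3) = j % (P.n + 3) := by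
  rw [Fin.ext_iff]
  rfl

theorem latticeVertex_periodic (k : ℕ) : P.latticeVertex (k + (P.n + 3)) = P.latticeVertex k := by
  rw [latticeVertex, latticeVertex, P.ofNat_eq_iff.2]
  simp

theorem lineMap_injective {i j : ℕ} {s t : ℝ} (hs : s ∈ Set.Ico (0 : ℝ) 1)
    (ht : t ∈ Set.Ico (0 : ℝ) 1)
    (h : AffineMap.lineMap (P.complexVertex i) (P.complexVertex (i + 1)) s =
      AffineMap.lineMap (P.complexVertex j) (P.complexVertex (j + 1)) t) :
    i % (P.n + 3) = j % (P.n + 3) ∧ s = t := by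
  rw [← P.ofNat_eq_iff]
  refine P.simple _ _ s hs t ht (planeToComplex_injective ?_)
  rw [planeToComplex_lineMap, planeToComplex_lineMap]
  simpa only [planeToComplex_latticePoint, complexVertex, latticeVertex, ofNat_succ] using h

theorem complexVertex_injective {i j : ℕ} (h : P.complexVertex i = P.complexVertex j) :
    i % (P.n + 3) = j % (P.n + 3) :=
  (P.lineMap_injective (s := 0) (t := 0) (by simp) (by simp) (by simpa using h)).1

theorem sub_ne_zero (i : ℕ) : P.complexVertex (i + 1) - P.complexVertex i ≠ 0 := by
  intro h
  have := (P.lineMap_injective (i := i) (j := i) (s := 0) (t := 1 / 2) (by simp) (by norm_num)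
    (by rw [sub_eq_zero.1 h]; simp)).2
  norm_num at this

theorem add_one_mod_ne (i : ℕ) : i % (P.n + 3) ≠ (i + 1) % (P.n + 3) := by
  intro h
  have h1 : (i + 0) % (P.n + 3) = (i + 1) % (P.n + 3) := h
  have := Nat.ModEq.add_left_cancel' i h1
  rw [Nat.ModEq, Nat.zero_mod, Nat.mod_eq_of_lt (by omega)] at this
  omega

theorem isPeriodicLoop : IsPeriodicLoop (P.n + 2) P.complexVertex where
  two_le := by omega
  periodic i := by
    rw [complexVertex, complexVertex, ← P.latticeVertex_periodic i]
  turn i := by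
    by_contra hs
    have h0 := P.sub_ne_zero i
    have h1 := P.sub_ne_zero (i + 1)
    set e := P.complexVertex (i + 1) - P.complexVertex i with he
    set e' := P.complexVertex (i + 2) - P.complexVertex (i + 1) with he'
    rw [mem_slitPlane_iff, not_or, not_lt, not_not] at hs
    set r := (e' / e).re with hr
    have hq : e' / e = (r : ℂ) := Complex.ext (by simp [hr]) (by simp [hs.2])
    rw [div_eq_iff h0] at hq
    have hr0 : r < 0 := by
      refine hs.1.lt_of_ne fun h => h1 ?_
      rw [hq, h]; simp
    -- If the next side ran back along side i, the point at distance τ‖e‖ before the common vertex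
    -- would lie on both; this τ keeps both parameters in [0, 1).
    set τ := min 1 (-r) / 2 with hτ
    have hm0 : 0 < min 1 (-r) := lt_min one_pos (by linarith)
    have hm1 := min_le_left 1 (-r)
    have hm2 := min_le_right 1 (-r)
    refine P.add_one_mod_ne i (P.lineMap_injective (i := i) (j := i + 1) (s := 1 - τ)
      (t := τ / (-r)) ⟨by linarith, by linarith⟩ ⟨div_nonneg (by linarith) (by linarith), ?_⟩ ?_).1
    · rw [div_lt_one (by linarith)]; linarith
    · rw [AffineMap.lineMap_apply, AffineMap.lineMap_apply]
      simp only [vsub_eq_sub, vadd_eq_add, real_smul]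
      change _ * e + _ = _ * e' + _
      rw [hq]
      have hrc : (r : ℂ) ≠ 0 := by exact_mod_cast hr0.ne
      have : P.complexVertex (i + 1) = P.complexVertex i + e := by rw [he]; ring
      rw [this]
      push_cast
      field_simp
      ring
  disj i j hij hj := by
    -- Simplicity is stated for half-open sides, so the end of side k counts as the start of side k
    -- + 1. The indices of a common point still differ by at least 1 and at most n + 2, hence are
    -- not congruent.
    have key : ∀ {k z}, z ∈ segment ℝ (P.complexVertex k) (P.complexVertex (k + 1)) →
        ∃ l, (l = k ∨ l = k + 1) ∧ ∃ s ∈ Set.Ico (0 : ℝ) 1,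
          AffineMap.lineMap (P.complexVertex l) (P.complexVertex (l + 1)) s = z := by
      intro k z hz
      rw [segment_eq_image_lineMap] at hz
      obtain ⟨s, hs, rfl⟩ := hz
      rcases hs.2.eq_or_lt with rfl | h1
      · exact ⟨k + 1, Or.inr rfl, 0, by simp, by simp⟩
      · exact ⟨k, Or.inl rfl, s, ⟨hs.1, h1⟩, rfl⟩
    rw [Set.disjoint_left]
    intro z hz1 hz2
    obtain ⟨k, hk, s, hs, h1⟩ := key hz1
    obtain ⟨l, hl, t, ht, h2⟩ := key hz2
    have hmod := (P.lineMap_injective hs ht (h1.trans h2.symm)).1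
    have hkl : k < l := by omega
    have hdvd := (Nat.modEq_iff_dvd' hkl.le).1 hmod
    have := Nat.le_of_dvd (by omega) hdvd
    omega

theorem planeToComplex_mem_loopTrace_iff {x : ℝ × ℝ} :
    planeToComplex x ∈ loopTrace (P.n + 2) P.complexVertex ↔ x ∈ P.boundary := by
  rw [boundary, Set.mem_iUnion]
  constructor
  · rintro ⟨i, hi, hx⟩
    refine ⟨Fin.ofNat (P.n + 3) i, planeToComplex_mem_segment_iff.1 ?_⟩
    simpa only [planeToComplex_latticePoint, complexVertex, latticeVertex, ofNat_succ]
      using hx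
  · rintro ⟨i, hx⟩
    refine ⟨i, by omega, ?_⟩
    rw [complexVertex, complexVertex, latticeVertex_val, latticeVertex_val_succ]
    exact planeToComplex_mem_segment_iff.2 hx

theorem latticeToComplex_mem_loopTrace_iff {z : ℤ × ℤ} :
    latticeToComplex z ∈ loopTrace (P.n + 2) P.complexVertex ↔ latticePoint z ∈ P.boundary := by
  rw [← planeToComplex_latticePoint, P.planeToComplex_mem_loopTrace_iff]

theorem isBounded_connectedComponentIn_iff (x : ℝ × ℝ) (hx : x ∉ P.boundary) :
    Bornology.IsBounded (connectedComponentIn P.boundaryᶜ x) ↔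
      Bornology.IsBounded (connectedComponentIn (loopTrace (P.n + 2) P.complexVertex)ᶜ
        (planeToComplex x)) := by
  have h1 := (Complex.equivRealProdCLM.symm.toHomeomorph).image_connectedComponentIn
    (s := P.boundaryᶜ) (x := x) hx
  have h2 : Complex.equivRealProdCLM.symm.toHomeomorph '' P.boundaryᶜ =
      (loopTrace (P.n + 2) P.complexVertex)ᶜ := by
    ext z
    constructor
    · rintro ⟨y, hy, rfl⟩ hz
      exact hy (P.planeToComplex_mem_loopTrace_iff.1 hz)
    · intro hz
      exact ⟨(z.re, z.im), fun h => hz (P.planeToComplex_mem_loopTrace_iff.2 h), rfl⟩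
  have h3 : Complex.equivRealProdCLM.symm.toHomeomorph x = planeToComplex x := rfl
  rw [h2, h3] at h1
  rw [← h1]
  constructor
  · intro h
    exact Complex.equivRealProdCLM.symm.lipschitz.isBounded_image h
  · intro h
    have := Complex.equivRealProdCLM.lipschitz.isBounded_image h
    rw [Set.image_image] at this
    simpa using this

/-- Twice the signed area, by the shoelace formula. -/
def shoelace : ℤ := ∑ i ∈ Finset.range (P.n + 3),
  latticeDet (P.latticeVertex i) (P.latticeVertex (i + 1))

theorem shoelace_eq : P.shoelace = ∑ i : Fin (P.n + 3),
    ((P.vertex i).1 * (P.vertex (i + 1)).2 - (P.vertex (i + 1)).1 * (P.vertex i).2) := by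
  rw [shoelace, Finset.sum_range]
  refine Finset.sum_congr rfl fun i _ => ?_
  rw [latticeVertex_val, latticeVertex_val_succ, latticeDet]

theorem shoelace_pos : 0 < P.shoelace := by
  rw [shoelace_eq]; exact P.counterclockwise

/-- The winding angle of the boundary. -/
noncomputable def winding (x : ℂ) : ℝ := windingAngle (P.n + 2) P.complexVertex x

theorem latticeVertex_closed : P.latticeVertex (P.n + 2 + 1) = P.latticeVertex 0 := by
  simpa using P.latticeVertex_periodic 0

theorem integral_winding_volume :
    ∫ x, P.winding (planeToComplex x) = Real.pi * P.shoelace := by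
  have := (isLatticeInvariant_volume.integral_windingAngle integral_squareAngle_volume
    P.latticeVertex_closed).2
  rw [shoelace]
  push_cast
  exact this

theorem integral_winding_count :
    ∫ z, P.winding (latticeToComplex z) ∂Measure.count = Real.pi * P.shoelace := by
  have := (isLatticeInvariant_count.integral_windingAngle integral_squareAngle_count
    P.latticeVertex_closed).2
  rw [shoelace]
  push_cast
  exact this

theorem volume_boundary : volume P.boundary = 0 :=
  measure_iUnion_null fun _ => volume_segment _ _

/-- If the turning were -2π, the winding angle would be 0 or -2π almost everywhere, against the
positivity of its integral π times the shoelace sum. -/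
theorem totalTurn_eq : totalTurn (P.n + 2) P.complexVertex = 2 * Real.pi := by
  have hpi := Real.pi_pos
  rcases P.isPeriodicLoop.totalTurn_eq_or with h | h
  · exact h
  · exfalso
    have h1 : ∫ x, P.winding (planeToComplex x) ≤ 0 := by
      refine integral_nonpos_of_ae ?_
      filter_upwards [compl_mem_ae_iff.2 P.volume_boundary] with x hx
      rcases P.isPeriodicLoop.windingAngle_eq_or
        (fun h' => hx (P.planeToComplex_mem_loopTrace_iff.1 h')) with h' | h'
      · rw [winding, h', h, Pi.zero_apply]; linarith
      · rw [winding, h', h, Pi.zero_apply]; linarith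
    rw [P.integral_winding_volume] at h1
    have : (0 : ℝ) < P.shoelace := by exact_mod_cast P.shoelace_pos
    have := mul_pos hpi this
    linarith

theorem winding_eq_or {x : ℂ} (hx : x ∉ loopTrace (P.n + 2) P.complexVertex) :
    P.winding x = 2 * Real.pi ∨ P.winding x = 0 := by
  rcases P.isPeriodicLoop.windingAngle_eq_or hx with h | h
  · left; rw [winding, h, P.totalTurn_eq]; ring
  · right; rw [winding, h, P.totalTurn_eq]; ring

theorem region_eq :
    P.region = P.boundary ∪ {x | P.winding (planeToComplex x) = 2 * Real.pi} := by
  ext x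
  simp only [region, Set.mem_union, Set.mem_ofPred_eq]
  by_cases hx : x ∈ P.boundary
  · simp [hx]
  · simp only [hx, not_false_eq_true, true_and, false_or]
    rw [P.isBounded_connectedComponentIn_iff x hx,
      P.isPeriodicLoop.isBounded_connectedComponentIn_iff P.totalTurn_eq
        (fun h' => hx (P.planeToComplex_mem_loopTrace_iff.1 h'))]
    rfl

theorem measurable_winding : Measurable P.winding := by
  unfold winding windingAngle
  exact Finset.measurable_fun_sum _ fun _ _ => measurable_sight _ _

theorem measurableSet_region : MeasurableSet P.region := by
  rw [region_eq]
  refine MeasurableSet.union ?_ ?_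
  · refine MeasurableSet.iUnion fun i => ?_
    rw [segment_eq_image_lineMap]
    exact (isCompact_Icc.image (by fun_prop)).isClosed.measurableSet
  · exact (P.measurable_winding.comp isLatticeInvariant_volume.measurable)
      (measurableSet_singleton _)

/-- The shoelace formula. -/
theorem A_eq : P.A = P.shoelace / 2 := by
  have hpi := Real.pi_pos
  have h1 : (fun x => P.winding (planeToComplex x)) =ᵐ[volume]
      P.region.indicator fun _ => 2 * Real.pi := by
    filter_upwards [compl_mem_ae_iff.2 P.volume_boundary] with x hx
    by_cases hr : P.winding (planeToComplex x) = 2 * Real.pi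
    · rw [Set.indicator_of_mem (by rw [region_eq]; exact Or.inr hr), hr]
    · rw [Set.indicator_of_notMem (by
        rw [region_eq]; exact fun h => h.elim (fun h => hx h) (fun h => hr h))]
      exact (P.winding_eq_or
        (fun h' => hx (P.planeToComplex_mem_loopTrace_iff.1 h'))).resolve_left hr
  have h2 := integral_congr_ae h1
  rw [P.integral_winding_volume, integral_indicator_const _ P.measurableSet_region,
    smul_eq_mul] at h2
  have h3 : Real.pi * P.shoelace = Real.pi * (2 * P.A) := by rw [h2, A]; ring
  have := mul_left_cancel₀ hpi.ne' h3
  linarith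

theorem normal_eq (i : Fin (P.n + 3)) :
    P.normal i = -I * (P.complexVertex (i + 1) - P.complexVertex i) := by
  rw [complexVertex, complexVertex, latticeVertex_val, latticeVertex_val_succ]
  apply Complex.ext <;> simp [normal, latticeToComplex]

/-- The normals are the sides times -I, a factor that cancels from the quotients; the sum of angles
is the total turning. -/
theorem C_eq : P.C = 1 := by
  have h : ∑ i : Fin (P.n + 3), (P.normal (i + 1) / P.normal i).arg = 2 * Real.pi := by
    rw [← P.totalTurn_eq, P.isPeriodicLoop.totalTurn_eq, Finset.sum_range]
    refine Finset.sum_congr rfl fun i _ => ?_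
    have e : P.normal (i + 1) = -I * (P.complexVertex (i + 2) - P.complexVertex (i + 1)) := by
      have e1 : P.complexVertex (i + 1) = latticeToComplex (P.vertex (i + 1)) := by
        rw [complexVertex, latticeVertex_val_succ]
      have e2 : P.complexVertex (i + 2) = latticeToComplex (P.vertex (i + 1 + 1)) := by
        rw [complexVertex, latticeVertex, ofNat_succ, ofNat_succ, ofNat_val]
      rw [e1, e2]
      apply Complex.ext <;> simp [normal, latticeToComplex]
    rw [e, normal_eq, mul_div_mul_left _ _ (neg_ne_zero.2 I_ne_zero), turnAngle]
  rw [C, rotationNumber, h, div_self (by positivity)]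

/-- The lattice points on the boundary. -/
def boundaryLattice : Set (ℤ × ℤ) := {p | latticePoint p ∈ P.boundary}

theorem exists_finset : ∃ s : Finset (ℤ × ℤ), P.boundaryLattice ⊆ s ∧
    ∀ z ∉ s, P.winding (latticeToComplex z) = 0 := by
  obtain ⟨R, -, hR⟩ := exists_far (P.n + 2) P.isPeriodicLoop.closed
  have hfin : (latticeToComplex ⁻¹' Metric.closedBall 0 R).Finite :=
    Measure.count_apply_lt_top.1 (isLatticeInvariant_count.finite R).lt_top
  refine ⟨hfin.toFinset, fun z hz => ?_, fun z hz => ?_⟩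
  · rw [Set.Finite.coe_toFinset, Set.mem_preimage, mem_closedBall_zero_iff]
    by_contra hlt
    exact (hR _ (not_le.1 hlt)).1 (P.latticeToComplex_mem_loopTrace_iff.2 hz)
  · rw [Set.Finite.mem_toFinset, Set.mem_preimage, mem_closedBall_zero_iff, not_le] at hz
    exact (hR _ hz).2

theorem finite_boundaryLattice : P.boundaryLattice.Finite := by
  obtain ⟨s, hs, -⟩ := P.exists_finset
  exact s.finite_toSet.subset hs

theorem latticeVertex_mem (i : ℕ) : P.latticeVertex i ∈ P.boundaryLattice :=
  P.latticeToComplex_mem_loopTrace_iff.1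
    (P.isPeriodicLoop.mem_loopTrace_iff.2 ⟨i, left_mem_segment ℝ _ _⟩)

/-- At most one index contributes to the sum. Written this way, vertices and other boundary points
are treated alike, and summation over z collects each exterior angle once. -/
theorem winding_boundary {z : ℤ × ℤ} (hz : z ∈ P.boundaryLattice) :
    P.winding (latticeToComplex z) = Real.pi - ∑ i ∈ Finset.range (P.n + 3),
      if P.latticeVertex (i + 1) = z then
        turnAngle (P.complexVertex i) (P.complexVertex (i + 1)) (P.complexVertex (i + 2))
      else 0 := by
  by_cases hv : ∃ i < P.n + 3, P.latticeVertex (i + 1) = z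
  · obtain ⟨i, hi, rfl⟩ := hv
    rw [Finset.sum_eq_single_of_mem i (Finset.mem_range.2 hi), if_pos rfl]
    · have := P.isPeriodicLoop.windingAngle_vertex i
      rw [P.totalTurn_eq] at this
      rw [winding, ← complexVertex, this]
      ring
    · intro j hj hji
      rw [if_neg]
      intro h
      have h1 : (j + 1) ≡ (i + 1) [MOD (P.n + 3)] :=
        P.complexVertex_injective (congrArg latticeToComplex h)
      have h2 := Nat.ModEq.add_right_cancel' 1 h1
      exact hji (h2.eq_of_lt_of_lt (Finset.mem_range.1 hj) hi)
  · push Not at hv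
    rw [Finset.sum_eq_zero fun i hi => if_neg (hv i (Finset.mem_range.1 hi)), sub_zero, winding,
      P.isPeriodicLoop.windingAngle_of_mem (P.latticeToComplex_mem_loopTrace_iff.2 hz),
      P.totalTurn_eq]
    · ring
    · intro k hk
      have h1 := latticeToComplex_injective hk
      -- The index cyclically before k, because the sum refers to the vertices as j + 1.
      set j := (k + (P.n + 2)) % (P.n + 3) with hj
      refine hv j (Nat.mod_lt _ (by omega)) ?_
      rw [h1, latticeVertex, latticeVertex, P.ofNat_eq_iff.2]
      rw [hj, Nat.mod_add_mod]
      simp [add_assoc]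

/-- Pick's inequality. -/
theorem B_le : (P.B : ℝ) ≤ P.shoelace + 2 := by
  have hpi := Real.pi_pos
  obtain ⟨s, hs, hs0⟩ := P.exists_finset
  set b := P.finite_boundaryLattice.toFinset with hb
  have hB : P.B = b.card := Set.ncard_eq_toFinset_card _ P.finite_boundaryLattice
  have hbs : b ⊆ s := fun z hz => by
    rw [hb, Set.Finite.mem_toFinset] at hz
    exact hs hz
  have h1 := P.integral_winding_count
  rw [integral_count_eq_sum s hs0] at h1
  -- Lattice points off the boundary contribute 0 or 2π, so dropping them does not increase the sum.
  have h2 : ∑ z ∈ b, P.winding (latticeToComplex z) ≤ ∑ z ∈ s, P.winding (latticeToComplex z) := by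
    refine Finset.sum_le_sum_of_subset_of_nonneg hbs fun z _ hz => ?_
    rw [hb, Set.Finite.mem_toFinset] at hz
    rcases P.winding_eq_or (fun h => hz (P.latticeToComplex_mem_loopTrace_iff.1 h)) with h | h
    · rw [h]; positivity
    · rw [h]
  -- Each boundary point gives π, and the exterior angles subtract 2π in all.
  have h3 : ∑ z ∈ b, P.winding (latticeToComplex z) = b.card * Real.pi - 2 * Real.pi := by
    rw [Finset.sum_congr rfl fun z hz => P.winding_boundary
      ((Set.Finite.mem_toFinset P.finite_boundaryLattice).1 hz), Finset.sum_sub_distrib,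
      Finset.sum_const, nsmul_eq_mul, Finset.sum_comm, ← P.totalTurn_eq,
      P.isPeriodicLoop.totalTurn_eq]
    congr 1
    refine Finset.sum_congr rfl fun i _ => ?_
    rw [Finset.sum_ite_eq, if_pos]
    rw [Set.Finite.mem_toFinset]
    exact P.latticeVertex_mem _
  rw [hB]
  have h4 : Real.pi * (b.card : ℝ) ≤ Real.pi * (P.shoelace + 2) := by
    rw [mul_add, ← h1]; linarith
  exact le_of_mul_le_mul_left h4 hpi

theorem three_le_B : 3 ≤ P.B := by
  have hinj : Function.Injective P.vertex := by
    intro i j h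
    have := P.complexVertex_injective (i := i) (j := j)
      (by rw [complexVertex, complexVertex, latticeVertex_val, latticeVertex_val, h])
    rw [Nat.mod_eq_of_lt i.2, Nat.mod_eq_of_lt j.2] at this
    exact Fin.ext this
  have hsub : Set.range P.vertex ⊆ P.boundaryLattice := by
    rintro _ ⟨i, rfl⟩
    rw [← latticeVertex_val]
    exact P.latticeVertex_mem _
  have h1 := Set.ncard_le_ncard hsub P.finite_boundaryLattice
  have h2 : (Set.range P.vertex).ncard = P.n + 3 := by
    rw [← Set.image_univ, Set.ncard_image_of_injective _ hinj, Set.ncard_univ, Nat.card_eq_fintype_card,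
      Fintype.card_fin]
  rw [h2] at h1
  have : P.B = P.boundaryLattice.ncard := rfl
  omega

end LatticePolygon

/-! ### Polygons that realize the triples -/

theorem latticePoint_mem_segment_iff {z a b : ℤ × ℤ} :
    latticePoint z ∈ segment ℝ (latticePoint a) (latticePoint b) ↔
      ∃ s ∈ Set.Icc (0 : ℝ) 1, (z.1 : ℝ) = a.1 + s * (b.1 - a.1) ∧
        (z.2 : ℝ) = a.2 + s * (b.2 - a.2) := by
  rw [segment_eq_image']
  constructor
  · rintro ⟨s, hs, h⟩
    have h1 := congrArg Prod.fst h
    have h2 := congrArg Prod.snd h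
    simp only [latticePoint, Prod.fst_add, Prod.smul_fst, Prod.fst_sub, smul_eq_mul, Prod.snd_add,
      Prod.smul_snd, Prod.snd_sub] at h1 h2
    exact ⟨s, hs, h1.symm, h2.symm⟩
  · rintro ⟨s, hs, h1, h2⟩
    refine ⟨s, hs, Prod.ext ?_ ?_⟩
    · simp [latticePoint, h1]
    · simp [latticePoint, h2]

/-- A lattice segment whose endpoints lie on neighbouring horizontal lines has no other lattice
points. -/
theorem latticePoint_mem_segment_iff_of_snd {z a b : ℤ × ℤ} (h : b.2 = a.2 + 1) :
    latticePoint z ∈ segment ℝ (latticePoint a) (latticePoint b) ↔ z = a ∨ z = b := by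
  constructor
  · rw [latticePoint_mem_segment_iff]
    rintro ⟨s, hs, h1, h2⟩
    rw [h] at h2
    push_cast at h2
    have hs' : s = ((z.2 - a.2 : ℤ) : ℝ) := by push_cast; linarith
    have l0 : 0 ≤ z.2 - a.2 := by
      have := hs.1
      rw [hs'] at this
      exact_mod_cast this
    have l1 : z.2 - a.2 ≤ 1 := by
      have := hs.2
      rw [hs'] at this
      exact_mod_cast this
    rcases (by omega : z.2 - a.2 = 0 ∨ z.2 - a.2 = 1) with e | e
    · left
      rw [hs', e] at h1
      refine Prod.ext ?_ (by omega)
      have : (z.1 : ℝ) = a.1 := by simpa using h1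
      exact_mod_cast this
    · right
      rw [hs', e] at h1
      refine Prod.ext ?_ (by omega)
      have : (z.1 : ℝ) = b.1 := by simpa using h1
      exact_mod_cast this
  · rintro (rfl | rfl)
    · exact left_mem_segment ℝ _ _
    · exact right_mem_segment ℝ _ _

theorem latticePoint_mem_segment_steep {z : ℤ × ℤ} :
    latticePoint z ∈ segment ℝ (latticePoint (1, 2)) (latticePoint (0, 0)) ↔
      z = (1, 2) ∨ z = (0, 0) := by
  constructor
  · rw [latticePoint_mem_segment_iff]
    rintro ⟨s, hs, h1, h2⟩
    push_cast at h1 h2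
    have h3 : z.2 = 2 * z.1 := by
      have : (z.2 : ℝ) = 2 * z.1 := by linarith
      exact_mod_cast this
    have l0 : 0 ≤ z.1 := by
      have : (0 : ℝ) ≤ z.1 := by linarith [hs.2]
      exact_mod_cast this
    have l1 : z.1 ≤ 1 := by
      have : (z.1 : ℝ) ≤ 1 := by linarith [hs.1]
      exact_mod_cast this
    rcases (by omega : z.1 = 0 ∨ z.1 = 1) with e | e
    · right; exact Prod.ext e (by simp only; omega)
    · left; exact Prod.ext e (by simp only; omega)
  · rintro (rfl | rfl)
    · exact left_mem_segment ℝ _ _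
    · exact right_mem_segment ℝ _ _

theorem latticePoint_mem_segment_base {z : ℤ × ℤ} {k : ℤ} (hk : 0 < k) :
    latticePoint z ∈ segment ℝ (latticePoint (0, 0)) (latticePoint (k, 0)) ↔
      (0 ≤ z.1 ∧ z.1 ≤ k) ∧ z.2 = 0 := by
  have hk' : (0 : ℝ) < k := by exact_mod_cast hk
  rw [latticePoint_mem_segment_iff]
  constructor
  · rintro ⟨s, hs, h1, h2⟩
    push_cast at h1 h2
    have h3 : (0 : ℝ) ≤ z.1 := by nlinarith [hs.1]
    have h4 : (z.1 : ℝ) ≤ k := by nlinarith [hs.2]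
    have h5 : (z.2 : ℝ) = 0 := by linarith
    exact ⟨⟨by exact_mod_cast h3, by exact_mod_cast h4⟩, by exact_mod_cast h5⟩
  · rintro ⟨⟨h1, h2⟩, h3⟩
    have h1' : (0 : ℝ) ≤ z.1 := by exact_mod_cast h1
    have h2' : (z.1 : ℝ) ≤ k := by exact_mod_cast h2
    refine ⟨z.1 / k, ⟨by positivity, (div_le_one hk').2 h2'⟩, ?_, ?_⟩
    · push_cast; field_simp; ring
    · rw [h3]; simp

/-- The triangle with vertices `(0, 0)`, `(j, 1)`, `(1, 2)`. -/
def thinTriangle (j : ℤ) (hj : 0 < j) : LatticePolygon where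
  n := 0
  vertex := ![(0, 0), (j, 1), (1, 2)]
  simple := by
    have hj' : (1 : ℝ) ≤ j := by exact_mod_cast hj
    intro a b s hs t ht h
    obtain ⟨hs0, hs1⟩ := hs
    obtain ⟨ht0, ht1⟩ := ht
    fin_cases a <;> fin_cases b <;>
      simp [AffineMap.lineMap_apply, latticePoint] at h ⊢ <;> obtain ⟨h1, h2⟩ := h
    all_goals first | linarith | nlinarith | (rcases h2 with h2 | h2 <;> linarith)
  counterclockwise := by
    simp [Fin.sum_univ_three]
    omega

/-- The quadrangle with vertices `(0, 0)`, `(k, 0)`, `(j, 1)`, `(1, 2)`. -/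
def thinQuadrangle (k j : ℤ) (hk : 0 < k) (hj : 0 < j) : LatticePolygon where
  n := 1
  vertex := ![(0, 0), (k, 0), (j, 1), (1, 2)]
  simple := by
    have hj' : (1 : ℝ) ≤ j := by exact_mod_cast hj
    have hk' : (1 : ℝ) ≤ k := by exact_mod_cast hk
    intro a b s hs t ht h
    obtain ⟨hs0, hs1⟩ := hs
    obtain ⟨ht0, ht1⟩ := ht
    fin_cases a <;> fin_cases b <;>
      simp [AffineMap.lineMap_apply, latticePoint] at h ⊢ <;> obtain ⟨h1, h2⟩ := h
    all_goals first | linarith | nlinarith | (rcases h2 with h2 | h2 <;> linarith)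
  counterclockwise := by
    simp [Fin.sum_univ_four]
    omega

/-- This serves both families: for the triangle k = 0, and the base shrinks to the origin. -/
theorem ncard_eq_of_mem_iff {k j : ℤ} (hk : 0 ≤ k) {S : Set (ℤ × ℤ)}
    (hS : ∀ z, z ∈ S ↔ ((0 ≤ z.1 ∧ z.1 ≤ k) ∧ z.2 = 0) ∨ z = (j, 1) ∨ z = (1, 2)) :
    (S.ncard : ℤ) = k + 3 := by
  have e : S = ((Finset.Icc 0 k ×ˢ {0} ∪ {(j, 1), (1, 2)} : Finset (ℤ × ℤ)) : Set (ℤ × ℤ)) := by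
    ext z
    rw [hS, Finset.mem_coe, Finset.mem_union, Finset.mem_product, Finset.mem_Icc]
    simp only [Finset.mem_singleton, Finset.mem_insert]
  have hd : Disjoint (Finset.Icc 0 k ×ˢ {(0 : ℤ)}) {(j, 1), ((1 : ℤ), (2 : ℤ))} := by
    rw [Finset.disjoint_left]
    intro z hz hz'
    simp only [Finset.mem_product, Finset.mem_singleton, Finset.mem_insert] at hz hz'
    rcases hz' with rfl | rfl <;> simp at hz
  rw [e, Set.ncard_coe_finset, Finset.card_union_of_disjoint hd, Finset.card_product,
    Int.card_Icc, Finset.card_singleton, Finset.card_pair (by simp)]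
  push_cast
  rw [Int.toNat_of_nonneg (by omega)]
  ring

theorem thinTriangle_B (j : ℤ) (hj : 0 < j) : ((thinTriangle j hj).B : ℤ) = 3 := by
  refine (ncard_eq_of_mem_iff (k := 0) (j := j) le_rfl fun z => ?_).trans (by norm_num)
  have h0 := latticePoint_mem_segment_iff_of_snd (z := z) (a := (0, 0)) (b := (j, 1)) rfl
  have h1 := latticePoint_mem_segment_iff_of_snd (z := z) (a := (j, 1)) (b := (1, 2)) rfl
  have h2 := latticePoint_mem_segment_steep (z := z)
  have hz : ((0 ≤ z.1 ∧ z.1 ≤ 0) ∧ z.2 = 0) ↔ z = (0, 0) := by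
    rw [Prod.ext_iff]; simp only; omega
  rw [Set.mem_ofPred_eq, LatticePolygon.boundary, Set.mem_iUnion, hz]
  change (∃ i : Fin 3, latticePoint z ∈ segment ℝ (latticePoint (![(0, 0), (j, 1), (1, 2)] i))
    (latticePoint (![(0, 0), (j, 1), (1, 2)] (i + 1)))) ↔ _
  rw [Fin.exists_fin_succ, Fin.exists_fin_succ, Fin.exists_fin_one]
  simp only [Fin.reduceSucc, Fin.reduceAdd, Fin.isValue, Matrix.cons_val]
  rw [h0, h1, h2]
  tauto

theorem thinQuadrangle_B (k j : ℤ) (hk : 0 < k) (hj : 0 < j) :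
    ((thinQuadrangle k j hk hj).B : ℤ) = k + 3 := by
  refine ncard_eq_of_mem_iff (k := k) (j := j) hk.le fun z => ?_
  have h0 := latticePoint_mem_segment_base (z := z) hk
  have h1 := latticePoint_mem_segment_iff_of_snd (z := z) (a := (k, 0)) (b := (j, 1)) rfl
  have h2 := latticePoint_mem_segment_iff_of_snd (z := z) (a := (j, 1)) (b := (1, 2)) rfl
  have h3 := latticePoint_mem_segment_steep (z := z)
  have hz0 : z = (0, 0) → ((0 ≤ z.1 ∧ z.1 ≤ k) ∧ z.2 = 0) := by
    rintro rfl; simp [hk.le]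
  have hzk : z = (k, 0) → ((0 ≤ z.1 ∧ z.1 ≤ k) ∧ z.2 = 0) := by
    rintro rfl; simp [hk.le]
  rw [Set.mem_ofPred_eq, LatticePolygon.boundary, Set.mem_iUnion]
  change (∃ i : Fin 4,
    latticePoint z ∈ segment ℝ (latticePoint (![(0, 0), (k, 0), (j, 1), (1, 2)] i))
      (latticePoint (![(0, 0), (k, 0), (j, 1), (1, 2)] (i + 1)))) ↔ _
  rw [Fin.exists_fin_succ, Fin.exists_fin_succ, Fin.exists_fin_succ, Fin.exists_fin_one]
  simp only [Fin.reduceSucc, Fin.reduceAdd, Fin.isValue, Matrix.cons_val]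
  rw [h0, h1, h2, h3]
  constructor
  · rintro (h | (h | h) | (h | h) | (h | h))
    exacts [Or.inl h, Or.inl (hzk h), Or.inr (Or.inl h), Or.inr (Or.inl h), Or.inr (Or.inr h),
      Or.inr (Or.inr h), Or.inl (hz0 h)]
  · rintro (h | h | h)
    exacts [Or.inl h, Or.inr (Or.inl (Or.inr h)), Or.inr (Or.inr (Or.inl (Or.inr h)))]

theorem thinTriangle_A (j : ℤ) (hj : 0 < j) : (thinTriangle j hj).A = (2 * j - 1) / 2 := by
  have h : (thinTriangle j hj).shoelace = 2 * j - 1 := by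
    rw [LatticePolygon.shoelace_eq]
    change ∑ i : Fin 3, (((![(0, 0), (j, 1), (1, 2)] : Fin 3 → ℤ × ℤ) i).1 *
      ((![(0, 0), (j, 1), (1, 2)] : Fin 3 → ℤ × ℤ) (i + 1)).2 -
      ((![(0, 0), (j, 1), (1, 2)] : Fin 3 → ℤ × ℤ) (i + 1)).1 *
      ((![(0, 0), (j, 1), (1, 2)] : Fin 3 → ℤ × ℤ) i).2) = _
    rw [Fin.sum_univ_three]
    simp
    ring
  rw [LatticePolygon.A_eq, h]
  push_cast
  ring

theorem thinQuadrangle_A (k j : ℤ) (hk : 0 < k) (hj : 0 < j) :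
    (thinQuadrangle k j hk hj).A = (k + 2 * j - 1) / 2 := by
  have h : (thinQuadrangle k j hk hj).shoelace = k + 2 * j - 1 := by
    rw [LatticePolygon.shoelace_eq]
    change ∑ i : Fin 4, (((![(0, 0), (k, 0), (j, 1), (1, 2)] : Fin 4 → ℤ × ℤ) i).1 *
      ((![(0, 0), (k, 0), (j, 1), (1, 2)] : Fin 4 → ℤ × ℤ) (i + 1)).2 -
      ((![(0, 0), (k, 0), (j, 1), (1, 2)] : Fin 4 → ℤ × ℤ) (i + 1)).1 *
      ((![(0, 0), (k, 0), (j, 1), (1, 2)] : Fin 4 → ℤ × ℤ) i).2) = _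
    rw [Fin.sum_univ_four]
    simp
    ring
  rw [LatticePolygon.A_eq, h]
  push_cast
  ring

/-! ### The characterization -/

theorem proposition4p3 (a b : ℝ) (c : ℤ) (habc : (a, b, c) ∈ admissibleTriples) :
    (∃ P : LatticePolygon, P.A = a ∧ (P.B : ℝ) / 2 = b ∧ P.C = (c : ℝ)) ↔
      c = 1 ∧ a + 1 ≥ b ∧ b ≥ 3 / 2 := by
  constructor
  · rintro ⟨P, rfl, rfl, hC⟩
    rw [P.C_eq] at hC
    have h3 : (3 : ℝ) ≤ P.B := by exact_mod_cast P.three_le_B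
    refine ⟨by exact_mod_cast hC.symm, ?_, by linarith⟩
    rw [P.A_eq]
    linarith [P.B_le]
  · rintro ⟨rfl, hab, hb⟩
    obtain ⟨-, ⟨l, hl⟩, m, hm⟩ := habc
    simp only at hl hm
    have hl3 : 3 ≤ l := by
      have : (3 : ℝ) ≤ l := by linarith
      exact_mod_cast this
    -- With l = 2b and m = a + b, the equations l = k + 3 and 2a = k + 2j - 1 give k = l - 3 and j =
    -- m - l + 2. Thus j ≥ 1 is exactly a + 1 ≥ b, and k ≥ 0 is b ≥ 3/2.
    have hj : 0 < m - l + 2 := by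
      have : (0 : ℝ) < m - l + 2 := by linarith
      exact_mod_cast this
    rcases hl3.eq_or_lt with rfl | hl3
    · refine ⟨thinTriangle _ hj, ?_, ?_, by rw [LatticePolygon.C_eq]; simp⟩
      · rw [thinTriangle_A]
        push_cast at *
        linarith
      · have : ((thinTriangle _ hj).B : ℝ) = 3 := by exact_mod_cast thinTriangle_B _ hj
        rw [this, hl]; norm_num
    · have hk : 0 < l - 3 := by omega
      refine ⟨thinQuadrangle _ _ hk hj, ?_, ?_, by rw [LatticePolygon.C_eq]; simp⟩
      · rw [thinQuadrangle_A]
        push_cast at *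
        linarith
      · have : ((thinQuadrangle _ _ hk hj).B : ℝ) = (l - 3 : ℤ) + 3 := by
          exact_mod_cast thinQuadrangle_B _ _ hk hj
        rw [this, hl]; push_cast; ring
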